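/- Let $R$ be a commutative noetherian ring; all modules are finitely generated, and $n\ge 0$ is an integer. A module $C$ is *semidualizing* if the homothety map $R\to\operatorname{Hom}_R(C,C)$ is an isomorphism and $\operatorname{Ext}^i_R(C,C)=0$ for all $i>0$. For a module $C$ we use the following terminology. - $M$ is *$n$-$C$-torsionfree* if $\operatorname{Ext}^i_R(\operatorname{Tr}_CM,C)=0$ for all $1\le i\le n$, where $\operatorname{Tr}_CM$ is the cokernel of $\operatorname{Hom}_R(P_0,C)\to\operatorname{Hom}_R(P_1,C)$ for a presentation $P_1\to P_0\to M\to 0$ by projective modules. (For semidualizing $C$ the module $\operatorname{Tr}_CM$ is unique up to direct summands of finite direct sums of copies of $C$, so the choice of the presentation does not matter.) - $M$ is *$n$-$C$-syzygy* if there is an exact sequence $0\to M\to P_C^1\to P_C^2\to\cdots\to P_C^n$ in which each $P_C^i$ is a direct summand of a finite direct sum of copies of $C$ (no condition if $n=0$). - $R$ satisfies $(S_n)$ if $\operatorname{depth}R_{\mathfrak p}\ge\min\{n,\dim R_{\mathfrak p}\}$ for every prime ideal $\mathfrak p$ of $R$. - For an integer $k$, $R$ satisfies $(G_k^C)$ if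 $C_{\mathfrak p}$ has finite injective dimension over $R_{\mathfrak p}$ for every prime ideal $\mathfrak p$ of $R$ of height at most $k$. Let $C$ and $C'$ be semidualizing $R$-modules, and assume that $R$ satisfies $(S_n)$, $(G_{n-1}^C)$ and $(G_{n-1}^{C'})$. Then the following conditions are equivalent for an $R$-module $M$: 1. $M$ is $n$-$C$-torsionfree; 2. $M$ is $n$-$C'$-torsionfree; 3. $M$ is $n$-$C$-syzygy; 4. $M$ is $n$-$C'$-syzygy. -/

import Mathlib

universe u

namespace SemidualizingTorsion

open CategoryTheory

section

variable (R : Type u) [CommRing R]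

/-- `Ext^i_R(X, Y) = 0`. -/
def ExtVanishes (X Y : Type u) [AddCommGroup X] [Module R X] [AddCommGroup Y] [Module R Y]
    (i : ℕ) : Prop :=
  Subsingleton (Abelian.Ext (ModuleCat.of R X) (ModuleCat.of R Y) i)

/-- A (finitely generated) module `C` is semidualizing if the homothety map `R → Hom_R(C, C)` is
an isomorphism and `Ext^i_R(C, C) = 0` for all `i > 0`. -/
structure IsSemidualizing (C : Type u) [AddCommGroup C] [Module R C] : Prop where
  finite : Module.Finite R C
  homothety_bijective : Function.Bijective (LinearMap.lsmul R C : R → C →ₗ[R] C)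
  ext_vanishes : ∀ i : ℕ, 0 < i → ExtVanishes R C C i

/-- The beginning `P₁ → P₀ → M → 0` of a resolution of `M` by finitely generated projective
modules. -/
structure ProjPresentation (M : Type u) [AddCommGroup M] [Module R M] where
  P₁ : ModuleCat.{u} R
  P₀ : ModuleCat.{u} R
  finite₁ : Module.Finite R P₁
  finite₀ : Module.Finite R P₀
  projective₁ : Module.Projective R P₁
  projective₀ : Module.Projective R P₀
  d : P₁ →ₗ[R] P₀
  ε : P₀ →ₗ[R] M
  exact : Function.Exact d ε
  surjective : Function.Surjective ε

variable {R} in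
/-- The `C`-transpose of `M` computed from a presentation: the cokernel of
`Hom_R(P₀, C) → Hom_R(P₁, C)`. -/
abbrev ProjPresentation.transpose {M : Type u} [AddCommGroup M] [Module R M]
    (π : ProjPresentation R M) (C : Type u) [AddCommGroup C] [Module R C] : Type u :=
  (π.P₁ →ₗ[R] C) ⧸ LinearMap.range (π.d.lcomp R C : (π.P₀ →ₗ[R] C) →ₗ[R] (π.P₁ →ₗ[R] C))

/-- `M` is `n`-`C`-torsionfree: `Ext^i_R(Tr_C M, C) = 0` for `1 ≤ i ≤ n`. The transpose is unique
up to direct summands of finite direct sums of copies of `C`, so that any presentation may be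
used when `C` is semidualizing. -/
def IsTorsionfree (n : ℕ) (C M : Type u) [AddCommGroup C] [Module R C]
    [AddCommGroup M] [Module R M] : Prop :=
  ∃ π : ProjPresentation R M, ∀ i : ℕ, 1 ≤ i → i ≤ n → ExtVanishes R (π.transpose C) C i

/-- `P` is a direct summand of a finite direct sum of copies of `C`. -/
def IsSummandOfCopies (C P : Type u) [AddCommGroup C] [Module R C]
    [AddCommGroup P] [Module R P] : Prop :=
  ∃ (k : ℕ) (s : P →ₗ[R] (Fin k → C)) (r : (Fin k → C) →ₗ[R] P), r ∘ₗ s = LinearMap.id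

/-- `M` is `n`-`C`-syzygy: there is an exact sequence `0 → M → X₁ → ⋯ → Xₙ` with every `Xᵢ` a
direct summand of a finite direct sum of copies of `C`. Here `X₀` is `M` up to isomorphism, the
entries of the sequence beyond `Xₙ` play no role, and nothing is required for `n = 0`. -/
def IsSyzygy (n : ℕ) (C M : Type u) [AddCommGroup C] [Module R C]
    [AddCommGroup M] [Module R M] : Prop :=
  ∃ (X : ℕ → ModuleCat.{u} R) (d : ∀ i, X i →ₗ[R] X (i + 1)),
    Nonempty (M ≃ₗ[R] X 0) ∧
    (∀ i, 1 ≤ i → i ≤ n → IsSummandOfCopies R C (X i)) ∧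
    (1 ≤ n → Function.Injective (d 0)) ∧
    (∀ i, i + 1 < n → Function.Exact (d i) (d (i + 1)))

/-- Depth of a finitely generated module over a (noetherian) local ring: the supremum of the
lengths of regular sequences in the maximal ideal. Weak regularity is regularity for nonzero
finitely generated modules, and gives the zero module depth `∞`. -/
noncomputable def depth [IsLocalRing R] (N : Type u) [AddCommGroup N] [Module R N] : ℕ∞ :=
  ⨆ (rs : List R) (_ : (∀ r ∈ rs, r ∈ IsLocalRing.maximalIdeal R) ∧
    RingTheory.Sequence.IsWeaklyRegular N rs), (rs.length : ℕ∞)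

/-- Serre's condition `(S_n)` for the ring `R`: `depth R_𝔭 ≥ min {n, dim R_𝔭}` for all primes. -/
def SatisfiesS (n : ℕ) : Prop :=
  ∀ (p : Ideal R) [p.IsPrime],
    min (n : WithBot ℕ∞) (ringKrullDim (Localization.AtPrime p)) ≤
      (depth (Localization.AtPrime p) (Localization.AtPrime p) : WithBot ℕ∞)

/-- The condition `(G_k^C)`: `C_𝔭` has finite injective dimension over `R_𝔭` for every prime `𝔭`
of height at most `k`. The index is an integer, and the condition is empty for `k < 0`. -/
def SatisfiesG (k : ℤ) (C : Type u) [AddCommGroup C] [Module R C] : Prop :=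
  ∀ (p : Ideal R) [p.IsPrime] (h : ℕ), p.height = (h : ℕ∞) → (h : ℤ) ≤ k →
    injectiveDimension (ModuleCat.of (Localization.AtPrime p)
      (LocalizedModule p.primeCompl C)) < ⊤

end

end SemidualizingTorsion

/-! The pivot is a condition on `M` that mentions no semidualizing module: every weakly `R`-regular
sequence of length at most `n` is weakly `M`-regular. Such a sequence is also regular on each
semidualizing module, because `R ≅ Hom(C, C)` and the higher `Ext(C, C)` vanish
(`IsSemidualizing.isWeaklyRegular`). The depth lemma then carries regularity along an `n`-`C`-syzygy
sequence down to `M` (`IsSyzygy.isWeaklyRegular`). Conversely the condition makes `M` torsionfree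
over either module (`isTorsionfree_of_isWeaklyRegular`), which allows the change from `C` to `C'`.
That torsionfree modules are syzygies (`IsTorsionfree.isSyzygy`) follows by dualizing a free
resolution of `Hom(M, C)`.

For the hard implication, let `i ≤ n` be the least positive degree with `Ext^i(Tr M, C) ≠ 0`, and
let `p` be an associated prime of this module. If `p` has height at least `i`, then `(S_n)` puts a
regular sequence of length `i` inside `p`, and a depth count leaves no nonzero element killed by `p`
(`ProjPresentation.ext_eq_zero_of_depth`). If the height is smaller, then `R_p` is Cohen–Macaulay,
`M_p` is maximal Cohen–Macaulay or zero, and `C_p` has finite injective dimension; so `M`, and then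
its transpose, is acyclic for `C` at `p` (`locAcyclic_transpose`). Both cases contradict the choice
of `p`. -/

namespace SemidualizingTorsion

open CategoryTheory Abelian RingTheory.Sequence IsLocalRing
open scoped Pointwise

variable {R : Type u} [CommRing R]

/-! ### Long exact sequences of `Ext` for linear maps. -/

section les

variable {A B D Y : Type u} [AddCommGroup A] [Module R A] [AddCommGroup B] [Module R B]
  [AddCommGroup D] [Module R D] [AddCommGroup Y] [Module R Y]

/-- The short complex of modules attached to an exact pair of linear maps. -/
abbrev shortComplexOfExact (f : A →ₗ[R] B) (g : B →ₗ[R] D) (h : Function.Exact f g) :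
    ShortComplex (ModuleCat.{u} R) :=
  ShortComplex.mk (ModuleCat.ofHom f) (ModuleCat.ofHom g)
    (by rw [← ModuleCat.ofHom_comp, h.linearMap_comp_eq_zero]; rfl)

lemma shortExact_of_exact {f : A →ₗ[R] B} {g : B →ₗ[R] D} (hf : Function.Injective f)
    (h : Function.Exact f g) (hg : Function.Surjective g) :
    (shortComplexOfExact f g h).ShortExact where
  exact := (ShortComplex.ShortExact.moduleCat_exact_iff_function_exact _).mpr h
  mono_f := (ModuleCat.mono_iff_injective _).mpr hf
  epi_g := (ModuleCat.epi_iff_surjective _).mpr hg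

lemma ExtVanishes.eq_zero {i : ℕ} (h : ExtVanishes R A B i)
    (x : Ext (ModuleCat.of R A) (ModuleCat.of R B) i) : x = 0 :=
  h.elim _ _

lemma ExtVanishes.intro {i : ℕ}
    (h : ∀ x : Ext (ModuleCat.of R A) (ModuleCat.of R B) i, x = 0) : ExtVanishes R A B i :=
  ⟨fun a b => by rw [h a, h b]⟩

lemma extVanishes_zero_iff : ExtVanishes R A B 0 ↔ Subsingleton (A →ₗ[R] B) :=
  (Ext.addEquiv₀.trans ModuleCat.homAddEquiv).toEquiv.subsingleton_congr

lemma extVanishes_of_projective [Module.Projective R A] (i : ℕ) (hi : 0 < i) :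
    ExtVanishes R A B i := by
  obtain ⟨j, rfl⟩ := Nat.exists_eq_succ_of_ne_zero hi.ne'
  have : Projective (ModuleCat.of R A) := ModuleCat.projective_of_categoryTheory_projective _
  exact Ext.subsingleton_of_projective _ _ j

variable {f : A →ₗ[R] B} {g : B →ₗ[R] D}

lemma ExtVanishes.contra₁ (hf : Function.Injective f) (h : Function.Exact f g)
    (hg : Function.Surjective g) {i : ℕ} (hB : ExtVanishes R B Y i)
    (hD : ExtVanishes R D Y (i + 1)) : ExtVanishes R A Y i := by
  refine .intro fun x => ?_
  obtain ⟨y, rfl⟩ := Ext.contravariant_sequence_exact₁ (shortExact_of_exact hf h hg) _ x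
    (add_comm 1 i) (hD.eq_zero _)
  rw [hB.eq_zero y, Ext.comp_zero]

lemma ExtVanishes.contra₂ (hf : Function.Injective f) (h : Function.Exact f g)
    (hg : Function.Surjective g) {i : ℕ} (hA : ExtVanishes R A Y i)
    (hD : ExtVanishes R D Y i) : ExtVanishes R B Y i := by
  refine .intro fun x => ?_
  obtain ⟨y, rfl⟩ := Ext.contravariant_sequence_exact₂ (shortExact_of_exact hf h hg) _ x
    (hA.eq_zero _)
  rw [hD.eq_zero y, Ext.comp_zero]

lemma ExtVanishes.contra₃ (hf : Function.Injective f) (h : Function.Exact f g)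
    (hg : Function.Surjective g) {i : ℕ} (hA : ExtVanishes R A Y i)
    (hB : ExtVanishes R B Y (i + 1)) : ExtVanishes R D Y (i + 1) := by
  refine .intro fun x => ?_
  obtain ⟨y, rfl⟩ := Ext.contravariant_sequence_exact₃ (shortExact_of_exact hf h hg) _ x
    (hB.eq_zero _) (add_comm 1 i)
  rw [hA.eq_zero y, Ext.comp_zero]

lemma ExtVanishes.cov₃ (hf : Function.Injective f) (h : Function.Exact f g)
    (hg : Function.Surjective g) {i : ℕ} (hB : ExtVanishes R Y B i)
    (hA : ExtVanishes R Y A (i + 1)) : ExtVanishes R Y D i := by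
  refine .intro fun x => ?_
  obtain ⟨y, rfl⟩ := Ext.covariant_sequence_exact₃ _ (shortExact_of_exact hf h hg) x
    rfl (hA.eq_zero _)
  rw [hB.eq_zero y, Ext.zero_comp]

lemma ExtVanishes.of_injective (hf : Function.Injective f) (hB : ExtVanishes R Y B 0) :
    ExtVanishes R Y A 0 := by
  rw [extVanishes_zero_iff] at hB ⊢
  exact ⟨fun a b => LinearMap.ext fun y => hf (LinearMap.congr_fun
    (Subsingleton.elim (f ∘ₗ a) (f ∘ₗ b)) y)⟩

/-- Ext vanishing passes to retracts of the first variable. -/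
lemma ExtVanishes.retract_left (s : A →ₗ[R] B) (r : B →ₗ[R] A) (hrs : r ∘ₗ s = LinearMap.id)
    {i : ℕ} (hB : ExtVanishes R B Y i) : ExtVanishes R A Y i := by
  refine .intro fun x => ?_
  have h : ModuleCat.ofHom s ≫ ModuleCat.ofHom r = 𝟙 _ := by
    rw [← ModuleCat.ofHom_comp, hrs]; rfl
  rw [← Ext.mk₀_id_comp x, ← h, ← Ext.mk₀_comp_mk₀_assoc, hB.eq_zero ((Ext.mk₀ _).comp x _),
    Ext.comp_zero]

lemma ExtVanishes.retract_right (s : A →ₗ[R] B) (r : B →ₗ[R] A) (hrs : r ∘ₗ s = LinearMap.id)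
    {i : ℕ} (hB : ExtVanishes R Y B i) : ExtVanishes R Y A i := by
  refine .intro fun x => ?_
  have h : ModuleCat.ofHom s ≫ ModuleCat.ofHom r = 𝟙 _ := by
    rw [← ModuleCat.ofHom_comp, hrs]; rfl
  rw [← Ext.comp_mk₀_id x, ← h, ← Ext.mk₀_comp_mk₀, ← Ext.comp_assoc_of_second_deg_zero,
    hB.eq_zero (x.comp (Ext.mk₀ _) _), Ext.zero_comp]

lemma ExtVanishes.equiv_left (e : A ≃ₗ[R] B) {i : ℕ} (hB : ExtVanishes R B Y i) :
    ExtVanishes R A Y i :=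
  hB.retract_left e.toLinearMap e.symm.toLinearMap (by ext; simp)

lemma ExtVanishes.equiv_right (e : A ≃ₗ[R] B) {i : ℕ} (hB : ExtVanishes R Y B i) :
    ExtVanishes R Y A i :=
  hB.retract_right e.toLinearMap e.symm.toLinearMap (by ext; simp)

/-- The connecting map `Ext^i(A, Y) → Ext^{i+1}(D, Y)` of `0 → A → B → D → 0`. -/
lemma exists_connecting (hf : Function.Injective f) (h : Function.Exact f g)
    (hg : Function.Surjective g) (i : ℕ) (hB : ExtVanishes R B Y (i + 1)) :
    ∃ δ : Ext (ModuleCat.of R A) (ModuleCat.of R Y) i →ₗ[R]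
        Ext (ModuleCat.of R D) (ModuleCat.of R Y) (i + 1),
      Function.Surjective δ ∧ (ExtVanishes R B Y i → Function.Injective δ) := by
  have S := shortExact_of_exact hf h hg
  refine ⟨S.extClass.precompOfLinear R _ (add_comm 1 i), fun x => ?_, fun hB' => ?_⟩
  · exact Ext.contravariant_sequence_exact₃ S _ x (hB.eq_zero _) (add_comm 1 i)
  · refine (injective_iff_map_eq_zero _).mpr fun x hx => ?_
    obtain ⟨y, rfl⟩ := Ext.contravariant_sequence_exact₁ S _ x (add_comm 1 i) hx
    rw [hB'.eq_zero y, Ext.comp_zero]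

/-- The connecting map `Hom(A, Y) → Ext^1(D, Y)` of `0 → A → B → D → 0`. -/
lemma exists_connecting_zero (hf : Function.Injective f) (h : Function.Exact f g)
    (hg : Function.Surjective g) :
    ∃ δ : (A →ₗ[R] Y) →ₗ[R] Ext (ModuleCat.of R D) (ModuleCat.of R Y) 1,
      (∀ φ, δ φ = 0 ↔ ∃ ψ : B →ₗ[R] Y, ψ ∘ₗ f = φ) ∧
        (ExtVanishes R B Y 1 → Function.Surjective δ) := by
  have S := shortExact_of_exact hf h hg
  let e := (Ext.linearEquiv₀ (R := R) (X := ModuleCat.of R A) (Y := ModuleCat.of R Y)).trans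
    ModuleCat.homLinearEquiv
  refine ⟨S.extClass.precompOfLinear R _ (add_comm 1 0) ∘ₗ e.symm.toLinearMap,
    fun φ => ⟨fun hφ => ?_, ?_⟩,
    fun hB x => ?_⟩
  · obtain ⟨y, hy⟩ := Ext.contravariant_sequence_exact₁ S _ _ (add_comm 1 0) hφ
    obtain ⟨y, rfl⟩ := (Ext.mk₀_bijective _ _).2 y
    refine ⟨y.hom, ?_⟩
    rw [Ext.mk₀_comp_mk₀] at hy
    have := (Ext.mk₀_bijective _ _).1 (a₂ := ModuleCat.ofHom φ) hy
    have := congrArg ModuleCat.Hom.hom this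
    simpa using this
  · rintro ⟨ψ, rfl⟩
    have : e.symm (ψ ∘ₗ f) = (Ext.mk₀ (shortComplexOfExact f g h).f).comp
        (Ext.mk₀ (ModuleCat.ofHom ψ)) (zero_add 0) := by
      rw [Ext.mk₀_comp_mk₀]; rfl
    change S.extClass.comp (e.symm (ψ ∘ₗ f)) (add_comm 1 0) = 0
    rw [this, ← Ext.comp_assoc S.extClass _ _ (add_zero 1) (zero_add 0) (by simp), S.extClass_comp,
      Ext.zero_comp]
  · obtain ⟨y, hy⟩ := Ext.contravariant_sequence_exact₃ S _ x (hB.eq_zero _) (add_comm 1 0)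
    exact ⟨e y, by simpa using hy⟩

/-- Every map `A → Y` extends to `B` if `Ext^1(D, Y) = 0`. -/
lemma ExtVanishes.exists_extension (hf : Function.Injective f) (h : Function.Exact f g)
    (hg : Function.Surjective g) (hD : ExtVanishes R D Y 1) (φ : A →ₗ[R] Y) :
    ∃ ψ : B →ₗ[R] Y, ψ ∘ₗ f = φ := by
  obtain ⟨δ, h1, -⟩ := exists_connecting_zero (Y := Y) hf h hg
  exact (h1 φ).mp (hD.eq_zero _)

end les

lemma ExtVanishes.pi_left {A Y : Type u} [AddCommGroup A] [Module R A] [AddCommGroup Y] [Module R Y]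
    {i : ℕ} (h : ExtVanishes R A Y i) (k : ℕ) : ExtVanishes R (Fin k → A) Y i := by
  induction k with
  | zero =>
    exact .retract_left (B := A) 0 0 (LinearMap.ext fun x => Subsingleton.elim _ _) h
  | succ k ih =>
    have e : (Fin (k + 1) → A) ≃ₗ[R] A × (Fin k → A) := (Fin.consLinearEquiv R (fun _ => A)).symm
    refine .equiv_left e ?_
    exact .contra₂ (f := LinearMap.inl R A _) (g := LinearMap.snd R A _) LinearMap.inl_injective
      (Function.Exact.inl_snd) LinearMap.snd_surjective h ih

lemma ExtVanishes.exists_lift {A B D Y : Type u} [AddCommGroup A] [Module R A] [AddCommGroup B]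
    [Module R B] [AddCommGroup D] [Module R D] [AddCommGroup Y] [Module R Y]
    {f : A →ₗ[R] B} {g : B →ₗ[R] D} (hf : Function.Injective f) (h : Function.Exact f g)
    (hg : Function.Surjective g) (hA : ExtVanishes R Y A 1) (φ : Y →ₗ[R] D) :
    ∃ ψ : Y →ₗ[R] B, g ∘ₗ ψ = φ := by
  have S := shortExact_of_exact hf h hg
  obtain ⟨y, hy⟩ := Ext.covariant_sequence_exact₃ (ModuleCat.of R Y) S
    (Ext.mk₀ (ModuleCat.ofHom φ)) rfl (hA.eq_zero _)
  obtain ⟨y, rfl⟩ := (Ext.mk₀_bijective _ _).2 y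
  refine ⟨y.hom, ?_⟩
  rw [Ext.mk₀_comp_mk₀] at hy
  simpa using congrArg ModuleCat.Hom.hom ((Ext.mk₀_bijective _ _).1 hy)

/-! ### Regular sequences and exact sequences. -/

section quot

variable {A B D : Type u} [AddCommGroup A] [Module R A] [AddCommGroup B] [Module R B]
  [AddCommGroup D] [Module R D] {f : A →ₗ[R] B} {g : B →ₗ[R] D}

lemma mem_smul_top_iff {x : R} {a : A} :
    a ∈ x • (⊤ : Submodule R A) ↔ ∃ b, x • b = a := by
  simp [Submodule.mem_smul_pointwise_iff_exists]

lemma quotSMulTop_map_injective (hf : Function.Injective f) (h : Function.Exact f g) {x : R}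
    (hx : IsSMulRegular D x) : Function.Injective (QuotSMulTop.map x f) := by
  refine (injective_iff_map_eq_zero _).mpr fun a ha => ?_
  obtain ⟨a, rfl⟩ := Submodule.mkQ_surjective _ a
  have : f a ∈ x • (⊤ : Submodule R B) := (Submodule.Quotient.mk_eq_zero _).mp ha
  obtain ⟨b, hb⟩ := mem_smul_top_iff.mp this
  have hgb : g b = 0 := by
    apply hx
    simp only [smul_zero]
    rw [← map_smul, hb, h.apply_apply_eq_zero]
  obtain ⟨c, rfl⟩ := (h b).mp hgb
  refine (Submodule.Quotient.mk_eq_zero _).mpr (mem_smul_top_iff.mpr ⟨c, hf ?_⟩)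
  rw [map_smul, hb]

/-- Regularity along `0 → A → B → D → 0`: a sequence regular on `B`, and on `D` up to its last
term, is regular on `A`. -/
lemma isWeaklyRegular_of_dropLast (rs : List R) (hf : Function.Injective f)
    (h : Function.Exact f g) (hg : Function.Surjective g) (hB : IsWeaklyRegular B rs)
    (hD : IsWeaklyRegular D rs.dropLast) : IsWeaklyRegular A rs := by
  induction rs generalizing A B D with
  | nil => exact .nil R A
  | cons x rs ih =>
    rw [isWeaklyRegular_cons_iff] at hB ⊢
    refine ⟨hB.1.of_injective f hf, ?_⟩
    cases rs with
    | nil => exact .nil R _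
    | cons y l =>
      -- As `rs` is nonempty, `x` survives in the shortened sequence, so it is regular on `D` and
      -- reduction modulo `x` keeps the sequence left exact.
      rw [List.dropLast_cons_cons, isWeaklyRegular_cons_iff] at hD
      exact ih (quotSMulTop_map_injective hf h hD.1) (QuotSMulTop.map_exact x h hg)
        (QuotSMulTop.map_surjective x hg) hB.2 hD.2

lemma isWeaklyRegular_retract (rs : List R) (s : A →ₗ[R] B) (r : B →ₗ[R] A)
    (hrs : r ∘ₗ s = LinearMap.id) (hB : IsWeaklyRegular B rs) : IsWeaklyRegular A rs := by
  have key : ∀ a, r (s a) = a := fun a => LinearMap.congr_fun hrs a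
  induction rs generalizing A B with
  | nil => exact .nil R A
  | cons x rs ih =>
    rw [isWeaklyRegular_cons_iff] at hB ⊢
    refine ⟨hB.1.of_injective s (Function.LeftInverse.injective key), ?_⟩
    have : (QuotSMulTop.map x r) ∘ₗ (QuotSMulTop.map x s) = LinearMap.id := by
      rw [← QuotSMulTop.map_comp, hrs, QuotSMulTop.map_id]
    exact ih _ _ this hB.2 (LinearMap.congr_fun this)

lemma isWeaklyRegular_pi {rs : List R} (hA : IsWeaklyRegular A rs) (k : ℕ) :
    IsWeaklyRegular (Fin k → A) rs :=
  ((TensorProduct.piScalarRight R R A (Fin k)).isWeaklyRegular_congr rs).mp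
    hA.isWeaklyRegular_rTensor

lemma IsSummandOfCopies.isWeaklyRegular {C P : Type u} [AddCommGroup C] [Module R C]
    [AddCommGroup P] [Module R P] (h : IsSummandOfCopies R C P) {rs : List R}
    (hC : IsWeaklyRegular C rs) : IsWeaklyRegular P rs := by
  obtain ⟨k, s, r, hrs⟩ := h
  exact isWeaklyRegular_retract rs s r hrs (isWeaklyRegular_pi hC k)

/-- The easy half of Rees's theorem: the first term kills `Y`, hence acts as zero on `Ext(Y, A)`, so
every class comes from `Ext(Y, A/xA)` one degree lower. -/
lemma extVanishes_of_isWeaklyRegular {Y : Type u} [AddCommGroup Y] [Module R Y] (rs : List R)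
    (hY : ∀ r ∈ rs, r ∈ Module.annihilator R Y) (hA : IsWeaklyRegular A rs) :
    ∀ i < rs.length, ExtVanishes R Y A i := by
  induction rs generalizing A with
  | nil => simp
  | cons x rs ih =>
    rw [isWeaklyRegular_cons_iff] at hA
    have hx := hY x List.mem_cons_self
    intro i hi
    match i with
    | 0 => exact extVanishes_zero_iff.mpr (hA.1.linearMap_subsingleton_of_mem_annihilator hx)
    | i + 1 =>
      have ih' := ih (fun r hr => hY r (List.mem_cons_of_mem _ hr)) hA.2 i (by simpa using hi)
      refine .intro fun e => ?_
      have S : ((ModuleCat.of R A).smulShortComplex x).ShortExact :=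
        IsSMulRegular.smulShortComplex_shortExact hA.1
      have h0 : e.comp (Ext.mk₀ ((ModuleCat.of R A).smulShortComplex x).f) (add_zero (i + 1)) = 0 := by
        have := ConcreteCategory.congr_hom (Ext.postcomp_smul_id_eq_zero_of_mem_annihilator
          (M := ModuleCat.of R A) (N := ModuleCat.of R Y) hx (i + 1)) e
        exact this
      obtain ⟨y, rfl⟩ := Ext.covariant_sequence_exact₁ _ S e h0 rfl
      have : y = 0 := ih'.eq_zero y
      rw [this, Ext.zero_comp]
      rfl

end quot

/-! ### Regular sequences on semidualizing modules. -/

section semidualizing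

variable {C : Type u} [AddCommGroup C] [Module R C]

/-- `Hom(C, N) / x Hom(C, N) ≅ Hom(C, N / x N)` when `x` is regular on `N` and `Ext^1(C, N) = 0`. -/
lemma exists_quotSMulTop_hom_equiv {N : Type u} [AddCommGroup N] [Module R N] {x : R}
    (hx : IsSMulRegular N x) (h1 : ExtVanishes R C N 1) :
    Nonempty (QuotSMulTop x (C →ₗ[R] N) ≃ₗ[R] (C →ₗ[R] QuotSMulTop x N)) := by
  let φ : (C →ₗ[R] N) →ₗ[R] (C →ₗ[R] QuotSMulTop x N) :=
    LinearMap.llcomp R C N _ (Submodule.mkQ _)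
  have hsurj : Function.Surjective φ := fun f =>
    ExtVanishes.exists_lift (f := LinearMap.lsmul R N x) (g := Submodule.mkQ (x • ⊤)) hx
      (LinearMap.exact_lsmul_mkQ_smul_top N x) (Submodule.mkQ_surjective _) h1 f
  have hker : x • (⊤ : Submodule R (C →ₗ[R] N)) = LinearMap.ker φ := by
    ext f
    rw [mem_smul_top_iff, LinearMap.mem_ker]
    constructor
    · rintro ⟨g, rfl⟩
      ext c
      exact (Submodule.Quotient.mk_eq_zero _).mpr (mem_smul_top_iff.mpr ⟨g c, rfl⟩)
    · intro hf
      have : ∀ c, ∃ y, x • y = f c := fun c =>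
        mem_smul_top_iff.mp ((Submodule.Quotient.mk_eq_zero _).mp (LinearMap.congr_fun hf c))
      choose y hy using this
      refine ⟨⟨⟨y, fun a b => hx ?_⟩, fun r a => hx ?_⟩, ?_⟩
      · simp only [smul_add, hy, map_add]
      · simp only [RingHom.id_apply, hy, map_smul, smul_comm x r]
      · ext c; exact hy c
  exact ⟨(Submodule.quotEquivOfEq _ _ hker).trans (φ.quotKerEquivOfSurjective hsurj)⟩

/-- Regularity is read off from `Hom(C, N)`: modulo a regular element this becomes `Hom(C, N/xN)`,
and the `Ext` vanishing is inherited. Leaving `A` and `N` general lets the induction pass to these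
quotients. -/
lemma isWeaklyRegular_of_equiv_hom [IsNoetherianRing R] [Module.Finite R C]
    (hC : Module.annihilator R C = ⊥) (rs : List R) {A N : Type u} [AddCommGroup A] [Module R A]
    [AddCommGroup N] [Module R N] [Module.Finite R N] (e : A ≃ₗ[R] (C →ₗ[R] N))
    (hN : ∀ i, 0 < i → ExtVanishes R C N i) (hA : IsWeaklyRegular A rs) :
    IsWeaklyRegular N rs := by
  induction rs generalizing A N with
  | nil => exact .nil R N
  | cons x rs ih =>
    rw [isWeaklyRegular_cons_iff] at hA ⊢
    have hreg := (e.isSMulRegular_congr x).mp hA.1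
    have hxN : IsSMulRegular N x := by
      rw [isSMulRegular_iff_ker_lsmul_eq_bot]
      -- Maps from `C` into the `x`-torsion `K` are killed by `x`, hence zero. So the annihilator of
      -- `C` contains a `K`-regular element; that annihilator being zero, `K` is zero.
      let K := LinearMap.ker (LinearMap.lsmul R N x)
      have : Subsingleton (C →ₗ[R] K) := by
        refine subsingleton_of_forall_eq 0 fun f => ?_
        have : K.subtype ∘ₗ f = 0 := by
          refine hreg (show x • (K.subtype ∘ₗ f) = x • (0 : C →ₗ[R] N) from ?_)
          ext c
          rw [smul_zero]
          exact LinearMap.mem_ker.mp (f c).2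
        ext c
        exact LinearMap.congr_fun this c
      obtain ⟨r, hr, hrK⟩ := IsSMulRegular.subsingleton_linearMap_iff.mp this
      rw [hC, Submodule.mem_bot] at hr
      subst hr
      exact (Submodule.subsingleton_iff_eq_bot).mp (IsSMulRegular.zero_iff_subsingleton.mp hrK)
    refine ⟨hxN, ?_⟩
    obtain ⟨e'⟩ := exists_quotSMulTop_hom_equiv hxN (hN 1 one_pos)
    refine ih ((QuotSMulTop.congr x e).trans e') (fun i hi => ?_) hA.2
    exact .cov₃ (f := LinearMap.lsmul R N x) (g := Submodule.mkQ (x • ⊤)) hxN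
      (LinearMap.exact_lsmul_mkQ_smul_top N x) (Submodule.mkQ_surjective _) (hN i hi)
      (hN (i + 1) i.succ_pos)

/-- Every `R`-regular sequence is regular on a semidualizing module. -/
lemma IsSemidualizing.isWeaklyRegular [IsNoetherianRing R] (hC : IsSemidualizing R C)
    {rs : List R} (h : IsWeaklyRegular R rs) : IsWeaklyRegular C rs := by
  have := hC.finite
  refine isWeaklyRegular_of_equiv_hom ?_ rs
    (LinearEquiv.ofBijective (LinearMap.lsmul R C : R →ₗ[R] C →ₗ[R] C) hC.homothety_bijective)
    hC.ext_vanishes h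
  refine (Submodule.eq_bot_iff _).mpr fun r hr => hC.homothety_bijective.1 ?_
  ext c
  simpa using Module.mem_annihilator.mp hr c

end semidualizing

/-! ### Depth and Serre's condition. -/

lemma extVanishes_zero_quotient_iff {N : Type u} [AddCommGroup N] [Module R N] (I : Ideal R) :
    ExtVanishes R (R ⧸ I) N 0 ↔ ∀ x : N, (∀ s ∈ I, s • x = 0) → x = 0 := by
  rw [extVanishes_zero_iff]
  constructor
  · intro h x hx
    let f : R ⧸ I →ₗ[R] N := I.liftQ (LinearMap.toSpanSingleton R N x) fun s hs => by
      simpa using hx s hs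
    have : f (Submodule.Quotient.mk 1) = 0 := by rw [Subsingleton.elim f 0]; rfl
    rwa [Submodule.liftQ_apply, LinearMap.toSpanSingleton_apply, one_smul] at this
  · intro h
    refine subsingleton_of_forall_eq 0 fun f => ?_
    refine Submodule.linearMap_qext _ (LinearMap.ext_ring ?_)
    refine h _ fun s hs => ?_
    have : s • f (Submodule.Quotient.mk 1) = 0 := by
      rw [← map_smul, ← Submodule.Quotient.mk_smul, smul_eq_mul, mul_one,
        (Submodule.Quotient.mk_eq_zero I).mpr hs, map_zero]
    exact this

lemma mem_annihilator_quotient {I : Ideal R} {r : R} (h : r ∈ I) :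
    r ∈ Module.annihilator R (R ⧸ I) := by
  rwa [Ideal.annihilator_quotient]

lemma extVanishes_zero_quotient_ofList {N Y : Type u} [AddCommGroup N] [Module R N]
    [AddCommGroup Y] [Module R Y] (rs : List R) (hN : IsWeaklyRegular N rs)
    (h : ∀ i ≤ rs.length, ExtVanishes R Y N i) :
    ExtVanishes R Y (N ⧸ (Ideal.ofList rs • ⊤ : Submodule R N)) 0 := by
  induction rs generalizing N with
  | nil =>
    refine .equiv_right (Submodule.quotEquivOfEqBot _ ?_) (h 0 le_rfl)
    rw [Ideal.ofList_nil, Submodule.bot_smul]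
  | cons x rs ih =>
    rw [isWeaklyRegular_cons_iff] at hN
    refine .equiv_right (Submodule.quotOfListConsSMulTopEquivQuotSMulTopInner N x rs) ?_
    refine ih hN.2 fun i hi => ?_
    exact .cov₃ (f := LinearMap.lsmul R N x) (g := Submodule.mkQ (x • ⊤)) hN.1
      (LinearMap.exact_lsmul_mkQ_smul_top N x) (Submodule.mkQ_surjective _)
      (h i (by simp; omega)) (h (i + 1) (by simp; omega))

/-- A weakly regular sequence in the maximal ideal that is shorter than another one is not
maximal. -/
lemma eq_zero_of_maximalIdeal_smul [IsLocalRing R] (rs ys : List R) (hys : ∀ y ∈ ys, y ∈ maximalIdeal R)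
    (hrs' : IsWeaklyRegular R rs) (hys' : IsWeaklyRegular R ys) (hlen : rs.length < ys.length)
    (x : R ⧸ (Ideal.ofList rs • ⊤ : Submodule R R)) (hx : ∀ s ∈ maximalIdeal R, s • x = 0) :
    x = 0 :=
  (extVanishes_zero_quotient_iff _).mp (extVanishes_zero_quotient_ofList rs hrs' fun i hi =>
    extVanishes_of_isWeaklyRegular ys (fun r hr => mem_annihilator_quotient (hys r hr)) hys' i
      (by omega)) x hx

lemma exists_of_lt_depth [IsLocalRing R] {m : ℕ} {N : Type u} [AddCommGroup N] [Module R N]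
    (h : (m : ℕ∞) < depth R N) :
    ∃ ys : List R, (∀ y ∈ ys, y ∈ maximalIdeal R) ∧ IsWeaklyRegular N ys ∧ m < ys.length := by
  unfold depth at h
  obtain ⟨ys, h⟩ := lt_iSup_iff.mp h
  obtain ⟨h1, h⟩ := lt_iSup_iff.mp h
  exact ⟨ys, h1.1, h1.2, by exact_mod_cast h⟩

/-- Under `(S_n)`, a prime contains regular sequences of any length up to `n` and its height. -/
lemma SatisfiesS.exists_isWeaklyRegular [IsNoetherianRing R] {n : ℕ} (hS : SatisfiesS R n)
    (p : Ideal R) [p.IsPrime] (m : ℕ) (hmn : m ≤ n) (hmp : (m : ℕ∞) ≤ p.height) :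
    ∃ rs : List R, rs.length = m ∧ (∀ r ∈ rs, r ∈ p) ∧ IsWeaklyRegular R rs := by
  induction m with
  | zero => exact ⟨[], rfl, by simp, .nil R R⟩
  | succ m ih =>
    obtain ⟨rs, hlen, hmem, hreg⟩ := ih (by omega)
      (le_trans (by exact_mod_cast Nat.le_succ m) hmp)
    suffices h : Subsingleton (R ⧸ p →ₗ[R] R ⧸ (Ideal.ofList rs • ⊤ : Submodule R R)) by
      obtain ⟨r, hr, hreg'⟩ := IsSMulRegular.subsingleton_linearMap_iff.mp h
      rw [Ideal.annihilator_quotient] at hr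
      refine ⟨rs ++ [r], by simp [hlen], ?_, ?_⟩
      · intro x hx
        rcases List.mem_append.mp hx with hx | hx
        · exact hmem x hx
        · rw [List.mem_singleton] at hx; exact hx ▸ hr
      · rw [isWeaklyRegular_append_iff, isWeaklyRegular_singleton_iff]
        exact ⟨hreg, hreg'⟩
    rw [← extVanishes_zero_iff, extVanishes_zero_quotient_iff]
    intro u hu
    by_contra hu0
    -- An associated prime `q` containing `p` has height at least `m + 1` as well, so `(S_n)` makes
    -- the depth of `R_q` exceed `m`.
    obtain ⟨q, hq, huq⟩ := exists_le_isAssociatedPrime_of_isNoetherianRing R u hu0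
    have hpq : p ≤ q := fun s hs => huq (Submodule.mem_colon_singleton.mpr (by simpa using hu s hs))
    obtain ⟨hqp, v, hv⟩ := (isAssociatedPrime_iff).mp hq
    replace hv : ∀ s, s ∈ q ↔ s • v = 0 := fun s => by
      rw [hv, Submodule.mem_colon_singleton, Submodule.mem_bot]
    obtain ⟨a, rfl⟩ := Submodule.mkQ_surjective _ v
    have hv' : ∀ s, s ∈ q ↔ s * a ∈ Ideal.ofList rs := fun s => by
      rw [hv, ← map_smul, Submodule.mkQ_apply, Submodule.Quotient.mk_eq_zero]
      simp
    let A := Localization.AtPrime q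
    have hd := hS q
    rw [IsLocalization.AtPrime.ringKrullDim_eq_height q] at hd
    have hd' : (m : ℕ∞) < depth A A := by
      have h1 : ((m + 1 : ℕ) : ℕ∞) ≤ depth A A := by
        have h2 : ((m + 1 : ℕ) : ℕ∞) ≤ min (n : ℕ∞) q.height :=
          le_min (by exact_mod_cast hmn) (hmp.trans (Ideal.height_mono hpq))
        have h3 : ((min (n : ℕ∞) q.height : ℕ∞) : WithBot ℕ∞) ≤ (depth A A : WithBot ℕ∞) := by
          rw [WithBot.coe_min]; exact hd
        exact h2.trans (WithBot.coe_le_coe.mp h3)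
      exact lt_of_lt_of_le (by exact_mod_cast Nat.lt_succ_self m) h1
    obtain ⟨ys, hys, hys', hlt⟩ := exists_of_lt_depth hd'
    have hreg' : IsWeaklyRegular A (rs.map (algebraMap R A)) :=
      hreg.of_isLocalization A q.primeCompl
    have hmap : (Ideal.ofList (rs.map (algebraMap R A))) = (Ideal.ofList rs).map (algebraMap R A) :=
      (Ideal.map_ofList _ _).symm
    -- The image of `a` is a socle element of `R_q` modulo `rs`, and the excess depth kills it. Then
    -- some element outside `q` annihilates `v`, against the choice of `v`.
    have key := eq_zero_of_maximalIdeal_smul (rs.map (algebraMap R A)) ys hys hreg' hys'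
      (by simpa [hlen] using hlt) (Submodule.Quotient.mk (algebraMap R A a)) (by
        intro s hs
        obtain ⟨c, t, rfl⟩ := IsLocalization.exists_mk'_eq q.primeCompl s
        have hc : c ∈ q := (IsLocalization.AtPrime.mk'_mem_maximal_iff A q c t).mp hs
        rw [← Submodule.Quotient.mk_smul, Submodule.Quotient.mk_eq_zero]
        rw [smul_eq_mul, Ideal.mul_top, hmap, smul_eq_mul]
        rw [← IsLocalization.mk'_one (M := q.primeCompl) A a, ← IsLocalization.mk'_mul,
          IsLocalization.mk'_mem_map_algebraMap_iff]
        exact ⟨1, one_mem _, by simpa using (hv' c).mp hc⟩)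
    rw [Submodule.Quotient.mk_eq_zero, smul_eq_mul, Ideal.mul_top, hmap,
      IsLocalization.algebraMap_mem_map_algebraMap_iff q.primeCompl] at key
    obtain ⟨s, hs, hsa⟩ := key
    exact hs ((hv' s).mpr hsa)

/-- Each regular element moves the vanishing range up by one degree. For `N = R` and `b = 0` this
does the work of the Koszul resolution. -/
lemma ExtVanishes.quotient_ofList {N Y : Type u} [AddCommGroup N] [Module R N]
    [AddCommGroup Y] [Module R Y] (rs : List R) (hN : IsWeaklyRegular N rs) (b : ℕ)
    (h : ∀ i, b < i → ExtVanishes R N Y i) :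
    ∀ i, b + rs.length < i → ExtVanishes R (N ⧸ (Ideal.ofList rs • ⊤ : Submodule R N)) Y i := by
  induction rs generalizing N b with
  | nil =>
    intro i hi
    refine .equiv_left (Submodule.quotEquivOfEqBot _ ?_) (h i hi)
    rw [Ideal.ofList_nil, Submodule.bot_smul]
  | cons x rs ih =>
    intro i hi
    rw [isWeaklyRegular_cons_iff] at hN
    refine .equiv_left (Submodule.quotOfListConsSMulTopEquivQuotSMulTopInner N x rs) ?_
    refine ih hN.2 (b + 1) (fun j hj => ?_) i (by simp at hi; omega)
    obtain ⟨j, rfl⟩ : ∃ k, j = k + 1 := ⟨j - 1, by omega⟩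
    exact .contra₃ (f := LinearMap.lsmul R N x) (g := Submodule.mkQ (x • ⊤)) hN.1
      (LinearMap.exact_lsmul_mkQ_smul_top N x) (Submodule.mkQ_surjective _)
      (h j (by omega)) (h (j + 1) (by omega))

/-! ### Finite injective dimension over Cohen–Macaulay local rings. -/

section IsLocalRing

variable [IsLocalRing R] [IsNoetherianRing R] {C : Type u} [AddCommGroup C] [Module R C]
  [Module.Finite R C]

/-- Nakayama's lemma for `Ext`. -/
lemma ExtVanishes.of_quotSMulTop {N : Type u} [AddCommGroup N] [Module R N] [Module.Finite R N]
    {x : R} (hx : x ∈ maximalIdeal R) (hreg : IsSMulRegular N x) {i : ℕ}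
    (h : ExtVanishes R (QuotSMulTop x N) C (i + 1)) : ExtVanishes R N C i := by
  have S : ((ModuleCat.of R N).smulShortComplex x).ShortExact :=
    IsSMulRegular.smulShortComplex_shortExact hreg
  unfold ExtVanishes
  by_contra hne
  rw [not_subsingleton_iff_nontrivial] at hne
  -- The vanishing in degree `i + 1` makes `x` surjective on `Ext^i(N, C)`, and Nakayama applies.
  have hj : x ∈ (Module.annihilator R
      (Ext (ModuleCat.of R N) (ModuleCat.of R C) i)).jacobson :=
    (IsLocalRing.maximalIdeal_le_jacobson _) hx
  refine Submodule.top_ne_pointwise_smul_of_mem_jacobson_annihilator hj ?_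
  symm
  rw [eq_top_iff]
  intro e _
  obtain ⟨y, hy⟩ := Ext.contravariant_sequence_exact₁ S _ e (add_comm 1 i) (h.eq_zero _)
  have : e = x • (show Ext (ModuleCat.of R N) (ModuleCat.of R C) i from y) := by
    rw [← hy]
    have key : ∀ z : Ext (ModuleCat.of R N) (ModuleCat.of R C) i,
        (Ext.mk₀ (x • 𝟙 (ModuleCat.of R N))).comp z (zero_add i) = x • z := fun z => by
      rw [Ext.mk₀_smul, Ext.smul_comp, Ext.mk₀_id_comp]
    exact key y
  rw [this]
  exact Submodule.smul_mem_pointwise_smul _ _ ⊤ trivial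

/-- Modulo `rs` the ring has Krull dimension zero, so every associated prime of the quotient is the
maximal ideal. -/
lemma exists_injective_residue {rs : List R} (hmem : ∀ r ∈ rs, r ∈ maximalIdeal R)
    (hreg : IsWeaklyRegular R rs) (hdim : ringKrullDim R = rs.length) :
    ∃ f : (R ⧸ maximalIdeal R) →ₗ[R] (R ⧸ (Ideal.ofList rs • ⊤ : Submodule R R)),
      Function.Injective f := by
  have hreg' : IsRegular R rs :=
    (IsLocalRing.isRegular_iff_isWeaklyRegular_of_subset_maximalIdeal hmem).mpr hreg
  have hle : Ideal.ofList rs ≤ maximalIdeal R := Ideal.span_le.mpr hmem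
  have hd := ringKrullDim_add_length_eq_ringKrullDim_of_isRegular rs hreg'
  have hnt : Nontrivial (R ⧸ Ideal.ofList rs) :=
    Ideal.Quotient.nontrivial_iff.mpr fun h => (maximalIdeal.isMaximal R).ne_top (top_le_iff.mp (h ▸ hle))
  have h0 : Ring.KrullDimLE 0 (R ⧸ Ideal.ofList rs) := by
    rw [ringKrullDimZero_iff_ringKrullDim_eq_zero]
    rw [hdim] at hd
    exact ENat.WithBot.add_natCast_cancel.mp (hd.trans (zero_add _).symm)
  have hW : Nontrivial (R ⧸ (Ideal.ofList rs • ⊤ : Submodule R R)) := by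
    simpa using hnt
  obtain ⟨q, hq⟩ := associatedPrimes.nonempty R (R ⧸ (Ideal.ofList rs • ⊤ : Submodule R R))
  obtain ⟨hqp, v, hv⟩ := isAssociatedPrime_iff.mp hq
  have hIq : Ideal.ofList rs ≤ q := by
    intro s hs
    rw [hv, Submodule.mem_colon_singleton, Submodule.mem_bot]
    obtain ⟨a, rfl⟩ := Submodule.mkQ_surjective _ v
    rw [← map_smul, Submodule.mkQ_apply, Submodule.Quotient.mk_eq_zero]
    exact Submodule.smul_mem_smul hs trivial
  have hqm : q = maximalIdeal R := by
    have h1 : (q.map (Ideal.Quotient.mk (Ideal.ofList rs))).IsPrime :=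
      Ideal.map_isPrime_of_surjective Ideal.Quotient.mk_surjective (by simpa using hIq)
    have h2 : (q.map (Ideal.Quotient.mk (Ideal.ofList rs))).IsMaximal := inferInstance
    have h3 := Ideal.comap_isMaximal_of_surjective (Ideal.Quotient.mk (Ideal.ofList rs))
      Ideal.Quotient.mk_surjective (K := q.map (Ideal.Quotient.mk (Ideal.ofList rs)))
    rw [Ideal.comap_map_of_surjective' _ Ideal.Quotient.mk_surjective, Ideal.mk_ker,
      sup_eq_left.mpr hIq] at h3
    exact IsLocalRing.eq_maximalIdeal h3
  have hker : LinearMap.ker (LinearMap.toSpanSingleton R _ v) = maximalIdeal R := by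
    ext s
    rw [← hqm, hv, Submodule.mem_colon_singleton]
    simp
  exact ⟨Submodule.liftQ _ (LinearMap.toSpanSingleton R _ v) hker.ge,
    LinearMap.ker_eq_bot.mp (Submodule.ker_liftQ_eq_bot _ _ _ hker.le)⟩

/-- Over a Cohen–Macaulay local ring, finite injective dimension is at most the dimension. -/
lemma extVanishes_of_length_lt (hC : injectiveDimension (ModuleCat.of R C) < ⊤)
    {rs : List R} (hmem : ∀ r ∈ rs, r ∈ maximalIdeal R)
    (hreg : IsWeaklyRegular R rs) (hdim : ringKrullDim R = rs.length)
    (N : Type u) [AddCommGroup N] [Module R N] [Module.Finite R N] (i : ℕ) (hi : rs.length < i) :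
    ExtVanishes R N C i := by
  obtain ⟨T, hT⟩ := (injectiveDimension_ne_top_iff _).mp hC.ne
  -- Descending induction on the degree: `Ext^i` vanishes from `T + 1` on, and `k` bounds the
  -- distance to that range.
  suffices H : ∀ k i, rs.length < i → T + 1 ≤ i + k → ∀ (N : Type u) [AddCommGroup N] [Module R N]
      [Module.Finite R N], ExtVanishes R N C i from H (T + 1) i hi (by omega) N
  intro k
  induction k with
  | zero =>
    intro i _ hi N _ _ _
    exact HasInjectiveDimensionLT.subsingleton _ _ i hi _
  | succ k ih =>
    intro i hi hT' N _ _ hN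
    have ih' := ih (i + 1) (by omega) (by omega)
    -- A prime filtration reduces to `N = R/p`. The residue field embeds in `R/(rs)`, whose `Ext` is
    -- already zero in this degree; for other primes an element outside `p` permits Nakayama.
    refine IsNoetherianRing.induction_on_isQuotientEquivQuotientPrime R hN
      (motive := fun N _ _ _ => ExtVanishes R N C i) ?_ ?_ ?_
    · intro N _ _ _ _
      exact .retract_left (B := PUnit.{u + 1}) 0 0 (LinearMap.ext fun x => Subsingleton.elim _ _)
        (extVanishes_of_projective i (by omega))
    · intro N _ _ _ p e
      refine .equiv_left e ?_
      by_cases hp : p.1 = maximalIdeal R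
      · rw [hp]
        obtain ⟨f, hf⟩ := exists_injective_residue hmem hreg hdim
        exact .contra₁ hf (LinearMap.exact_map_mkQ_range f) (Submodule.mkQ_surjective _)
          (ExtVanishes.quotient_ofList rs hreg 0
            (fun j hj => extVanishes_of_projective j hj) i (by omega)) (ih' _)
      · obtain ⟨y, hy, hyp⟩ : ∃ y ∈ maximalIdeal R, y ∉ p.1 := by
          by_contra! h
          exact hp ((maximalIdeal.isMaximal R).eq_of_le p.2.ne_top h).symm
        refine .of_quotSMulTop hy (fun a b hab => ?_) (ih' _)
        have hpp := p.2
        obtain ⟨a, rfl⟩ := Ideal.Quotient.mk_surjective a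
        obtain ⟨b, rfl⟩ := Ideal.Quotient.mk_surjective b
        have h1 : Ideal.Quotient.mk p.1 (y * a) = Ideal.Quotient.mk p.1 (y * b) := hab
        rw [Ideal.Quotient.eq] at h1 ⊢
        rw [← mul_sub] at h1
        exact (hpp.mem_or_mem h1).resolve_left hyp
    · intro N₁ _ _ _ N₂ _ _ _ N₃ _ _ _ f g hf hg hfg h1 h3
      exact .contra₂ hf hfg hg h1 h3

/-- Maximal Cohen–Macaulay modules are acyclic for a module of finite injective dimension. -/
lemma extVanishes_of_isWeaklyRegular_of_injectiveDimension
    (hC : injectiveDimension (ModuleCat.of R C) < ⊤)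
    {rs : List R} (hmem : ∀ r ∈ rs, r ∈ maximalIdeal R)
    (hreg : IsWeaklyRegular R rs) (hdim : ringKrullDim R = rs.length)
    (N : Type u) [AddCommGroup N] [Module R N] [Module.Finite R N] (hN : IsWeaklyRegular N rs)
    (i : ℕ) (hi : 0 < i) : ExtVanishes R N C i := by
  -- Removing a term of `ys` costs one degree, so `i + ys.length` stays constant until the previous
  -- bound applies.
  suffices H : ∀ (ys : List R), (∀ r ∈ ys, r ∈ maximalIdeal R) → ∀ (N : Type u) [AddCommGroup N]
      [Module R N] [Module.Finite R N], IsWeaklyRegular N ys →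
      ∀ i, rs.length < i + ys.length → ExtVanishes R N C i from
    H rs hmem N hN i (by omega)
  intro ys
  induction ys with
  | nil => exact fun _ N _ _ _ _ i hi => extVanishes_of_length_lt hC hmem hreg hdim N i hi
  | cons y ys ih =>
    intro hys N _ _ _ hN i hi
    rw [isWeaklyRegular_cons_iff] at hN
    refine .of_quotSMulTop (hys y List.mem_cons_self) hN.1 ?_
    exact ih (fun r hr => hys r (List.mem_cons_of_mem _ hr)) _ hN.2 (i + 1)
      (by simp at hi; omega)

end IsLocalRing

/-! ### Maps that become injective or surjective after localization. -/

section localization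

variable (S : Submonoid R) {A B D : Type u} [AddCommGroup A] [Module R A] [AddCommGroup B]
  [Module R B] [AddCommGroup D] [Module R D]

lemma localizedModule_map_injective {f : A →ₗ[R] B}
    (h : ∀ a, f a = 0 → ∃ s ∈ S, s • a = 0) : Function.Injective (LocalizedModule.map S f) := by
  refine (injective_iff_map_eq_zero _).mpr fun x hx => ?_
  induction x using LocalizedModule.induction_on with
  | h a t =>
    rw [LocalizedModule.map_mk, ← LocalizedModule.zero_mk t, LocalizedModule.mk_eq] at hx
    obtain ⟨⟨s, hs⟩, hsa⟩ := hx
    rw [smul_zero, smul_zero, Submonoid.smul_def, Submonoid.smul_def, smul_smul] at hsa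
    rw [← map_smul] at hsa
    obtain ⟨s', hs', h'⟩ := h _ hsa
    rw [← LocalizedModule.zero_mk t, LocalizedModule.mk_eq]
    refine ⟨⟨s' * s, mul_mem hs' hs⟩, ?_⟩
    rw [smul_zero, smul_zero, Submonoid.smul_def, Submonoid.smul_def, smul_smul, mul_assoc,
      mul_smul, h']

lemma localizedModule_map_surjective {f : A →ₗ[R] B}
    (h : ∀ b, ∃ s ∈ S, ∃ a, f a = s • b) : Function.Surjective (LocalizedModule.map S f) := by
  intro x
  induction x using LocalizedModule.induction_on with
  | h b t =>
    obtain ⟨s, hs, a, ha⟩ := h b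
    refine ⟨LocalizedModule.mk a (⟨s, hs⟩ * t), ?_⟩
    rw [LocalizedModule.map_mk, ha]
    exact LocalizedModule.mk_cancel_common_left ⟨s, hs⟩ t b

lemma localizedModule_map_exact {f : A →ₗ[R] B} {g : B →ₗ[R] D} (h : Function.Exact f g) :
    Function.Exact (LocalizedModule.map S f) (LocalizedModule.map S g) :=
  LocalizedModule.map_exact S f g h

end localization

variable (R) in
lemma exists_free_cover [IsNoetherianRing R] (N : Type u) [AddCommGroup N] [Module R N]
    [Module.Finite R N] : ∃ (k : ℕ) (K : Type u) (_ : AddCommGroup K) (_ : Module R K)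
      (_ : Module.Finite R K) (f : K →ₗ[R] (Fin k → R)) (g : (Fin k → R) →ₗ[R] N),
      Function.Injective f ∧ Function.Exact f g ∧ Function.Surjective g := by
  obtain ⟨k, g, hg⟩ := Module.Finite.exists_fin' R N
  exact ⟨k, LinearMap.ker g, inferInstance, inferInstance, inferInstance,
    (LinearMap.ker g).subtype, g, Subtype.val_injective, g.exact_subtype_ker_map, hg⟩

lemma lcomp_exact {A B D Y : Type u} [AddCommGroup A] [Module R A] [AddCommGroup B]
    [Module R B] [AddCommGroup D] [Module R D] [AddCommGroup Y] [Module R Y] {f : A →ₗ[R] B}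
    {g : B →ₗ[R] D} (h : Function.Exact f g) (hg : Function.Surjective g) :
    Function.Exact (g.lcomp R Y) (f.lcomp R Y) :=
  LinearMap.exact_lcomp_of_exact_of_surjective Y h hg

lemma lcomp_injective {B D Y : Type u} [AddCommGroup B]
    [Module R B] [AddCommGroup D] [Module R D] [AddCommGroup Y] [Module R Y]
    {g : B →ₗ[R] D} (hg : Function.Surjective g) :
    Function.Injective (g.lcomp R Y) :=
  fun _ _ h => (LinearMap.cancel_right hg).mp h

/-! ### Acyclicity at a prime. -/

section locAcyclic

variable (p : Ideal R) [p.IsPrime] (C : Type u) [AddCommGroup C] [Module R C]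

/-- `Ext^i(N, C)_p = 0` for all `i > 0`. -/
def LocAcyclic (N : Type u) [AddCommGroup N] [Module R N] : Prop :=
  ∀ i, 0 < i → ∀ e : Ext (ModuleCat.of R N) (ModuleCat.of R C) i, ∃ s ∈ p.primeCompl, s • e = 0

variable {p C}

lemma LocAcyclic.of_exact {A B D : Type u} [AddCommGroup A] [Module R A] [AddCommGroup B]
    [Module R B] [Module.Projective R B] [AddCommGroup D] [Module R D] {f : A →ₗ[R] B}
    {g : B →ₗ[R] D} (hf : Function.Injective f) (h : Function.Exact f g)
    (hg : Function.Surjective g) (hD : LocAcyclic p C D) : LocAcyclic p C A := by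
  intro i hi e
  obtain ⟨δ, -, hδ⟩ := exists_connecting (Y := C) hf h hg i (extVanishes_of_projective _ i.succ_pos)
  obtain ⟨s, hs, hse⟩ := hD (i + 1) i.succ_pos (δ e)
  exact ⟨s, hs, hδ (extVanishes_of_projective _ hi) (by rw [map_smul, hse, map_zero])⟩

lemma LocAcyclic.exists_extension {A B D : Type u} [AddCommGroup A] [Module R A] [AddCommGroup B]
    [Module R B] [AddCommGroup D] [Module R D] {f : A →ₗ[R] B}
    {g : B →ₗ[R] D} (hf : Function.Injective f) (h : Function.Exact f g)
    (hg : Function.Surjective g) (hD : LocAcyclic p C D) (φ : A →ₗ[R] C) :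
    ∃ s ∈ p.primeCompl, ∃ ψ : B →ₗ[R] C, ψ ∘ₗ f = s • φ := by
  obtain ⟨δ, hδ, -⟩ := exists_connecting_zero (Y := C) hf h hg
  obtain ⟨s, hs, hse⟩ := hD 1 one_pos (δ φ)
  exact ⟨s, hs, (hδ _).mp (by rw [map_smul, hse])⟩

/-- Only `Hom` out of finitely presented modules needs to commute with localization: dimension
shifting reduces to degree one, where a class is the obstruction to extending a map from `K` to a
free module. -/
lemma locAcyclic_of_extVanishes [IsNoetherianRing R] (N : Type u) [AddCommGroup N] [Module R N]
    [Module.Finite R N] (h : ∀ i, 0 < i → ExtVanishes (Localization.AtPrime p)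
      (LocalizedModule p.primeCompl N) (LocalizedModule p.primeCompl C) i) :
    LocAcyclic p C N := by
  intro i hi
  obtain ⟨i, rfl⟩ := Nat.exists_eq_succ_of_ne_zero hi.ne'
  induction i generalizing N with
  | zero =>
    intro e
    obtain ⟨k, K, _, _, _, f, g, hf, hfg, hg⟩ := exists_free_cover R N
    obtain ⟨δ, hδ, hδ'⟩ := exists_connecting_zero (Y := C) hf hfg hg
    obtain ⟨φ, rfl⟩ := hδ' (extVanishes_of_projective _ one_pos) e
    obtain ⟨ψ, hψ⟩ := (h 1 one_pos).exists_extension (f := LocalizedModule.map p.primeCompl f)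
      (g := LocalizedModule.map p.primeCompl g)
      (localizedModule_map_injective _ fun a ha => ⟨1, one_mem _, by
        rw [(injective_iff_map_eq_zero f).mp hf a ha, smul_zero]⟩)
      (localizedModule_map_exact _ hfg)
      (localizedModule_map_surjective _ fun b => ⟨1, one_mem _, by
        simpa using hg b⟩) (LocalizedModule.map p.primeCompl φ)
    -- Clear denominators in the extension found over `R_p`. It restricts to a multiple of `φ` only
    -- after localizing, hence the second factor `t`.
    obtain ⟨⟨ψ', s⟩, hs⟩ := IsLocalizedModule.surj p.primeCompl
      (LocalizedModule.map p.primeCompl (M := Fin k → R) (N := C)) ψ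
    have : Module.FinitePresentation R K := Module.finitePresentation_of_finite R K
    have heq : LocalizedModule.map p.primeCompl (s • φ) =
        LocalizedModule.map p.primeCompl (ψ' ∘ₗ f) := by
      have hs' : (s : R) • ψ = LocalizedModule.map p.primeCompl ψ' := hs
      have : LocalizedModule.map p.primeCompl (ψ' ∘ₗ f) =
          (LocalizedModule.map p.primeCompl ψ') ∘ₗ (LocalizedModule.map p.primeCompl f) := by
        ext x
        induction x using LocalizedModule.induction_on with
        | h a t => simp [LocalizedModule.map_mk]
      rw [this, ← hs', LinearMap.smul_comp, hψ, Submonoid.smul_def, map_smul]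
    obtain ⟨t, ht⟩ := (IsLocalizedModule.eq_iff_exists p.primeCompl
      (LocalizedModule.map p.primeCompl (M := K) (N := C))).mp heq
    refine ⟨t * s, mul_mem t.2 s.2, ?_⟩
    rw [← map_smul, hδ]
    refine ⟨(t : R) • ψ', ?_⟩
    rw [LinearMap.smul_comp, mul_smul]
    exact ht.symm
  | succ i ih =>
    intro e
    obtain ⟨k, K, _, _, _, f, g, hf, hfg, hg⟩ := exists_free_cover R N
    obtain ⟨δ, hδ, -⟩ := exists_connecting (Y := C) hf hfg hg (i + 1)
      (extVanishes_of_projective _ (by omega))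
    obtain ⟨e, rfl⟩ := hδ e
    have hproj : Module.Projective (Localization.AtPrime p)
        (LocalizedModule p.primeCompl (Fin k → R)) :=
      Module.projective_of_isLocalizedModule p.primeCompl
        (LocalizedModule.mkLinearMap p.primeCompl (Fin k → R))
    obtain ⟨s, hs, hse⟩ := ih K (fun j hj =>
      .contra₁ (f := LocalizedModule.map p.primeCompl f)
      (g := LocalizedModule.map p.primeCompl g)
      (localizedModule_map_injective _ fun a ha => ⟨1, one_mem _, by
        rw [(injective_iff_map_eq_zero f).mp hf a ha, smul_zero]⟩)
      (localizedModule_map_exact _ hfg)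
      (localizedModule_map_surjective _ fun b => ⟨1, one_mem _, by
        simpa using hg b⟩) (extVanishes_of_projective j hj) (h (j + 1) j.succ_pos))
      (by omega) e
    exact ⟨s, hs, by rw [← map_smul, hse, map_zero]⟩

lemma isWeaklyRegular_hom_free {rs : List R} (hC : IsWeaklyRegular C rs) (k : ℕ) :
    IsWeaklyRegular ((Fin k → R) →ₗ[R] C) rs :=
  ((LinearEquiv.piRing R C (Fin k) R).isWeaklyRegular_congr rs).mpr (isWeaklyRegular_pi hC k)

end locAcyclic

section

variable {p : Ideal R} [p.IsPrime] {C : Type u} [AddCommGroup C] [Module R C]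

lemma isWeaklyRegular_localizedModule {rs : List R} {N : Type u} [AddCommGroup N] [Module R N]
    (h : IsWeaklyRegular N rs) : IsWeaklyRegular (LocalizedModule p.primeCompl N)
      (rs.map (algebraMap R (Localization.AtPrime p))) :=
  h.of_isLocalizedModule (Localization.AtPrime p) p.primeCompl
    (LocalizedModule.mkLinearMap p.primeCompl N)

lemma isWeaklyRegular_of_append_left {rs ys : List R} {N : Type u} [AddCommGroup N] [Module R N]
    (h : IsWeaklyRegular N (rs ++ ys)) : IsWeaklyRegular N rs :=
  ((isWeaklyRegular_append_iff _ _ _).mp h).1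

lemma isWeaklyRegular_dropLast {rs : List R} {N : Type u} [AddCommGroup N] [Module R N]
    (h : IsWeaklyRegular N rs) : IsWeaklyRegular N rs.dropLast := by
  rcases rs.eq_nil_or_concat with rfl | ⟨l, a, rfl⟩
  · exact h
  · rw [List.concat_eq_append] at h ⊢
    rw [List.dropLast_concat]
    exact isWeaklyRegular_of_append_left h

/-- If `Ext^i(N, C)_p = 0` for all `i > 0`, then `Hom(N, C)_p` is as deep as `C`. -/
lemma LocAcyclic.isWeaklyRegular_hom [IsNoetherianRing R] {N : Type u} [AddCommGroup N]
    [Module R N] [Module.Finite R N] (hN : LocAcyclic p C N) {rs : List R}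
    (hC : IsWeaklyRegular C rs) : IsWeaklyRegular (LocalizedModule p.primeCompl (N →ₗ[R] C))
      (rs.map (algebraMap R (Localization.AtPrime p))) := by
  induction hl : rs.length generalizing N rs with
  | zero =>
    rw [List.length_eq_zero_iff.mp hl]
    exact .nil _ _
  | succ m ih =>
    obtain ⟨k, K, _, _, _, f, g, hf, hfg, hg⟩ := exists_free_cover R N
    have hK : LocAcyclic p C K := hN.of_exact hf hfg hg
    -- Acyclicity makes the dual of the free cover short exact at `p`. The dual of `K` needs one
    -- term fewer, so induction on the length suffices.
    refine isWeaklyRegular_of_dropLast _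
      (f := LocalizedModule.map p.primeCompl (g.lcomp R C))
      (g := LocalizedModule.map p.primeCompl (f.lcomp R C)) ?_ ?_ ?_ ?_ ?_
    · exact localizedModule_map_injective _ fun a ha => ⟨1, one_mem _, by
        rw [(injective_iff_map_eq_zero _).mp (lcomp_injective hg) a ha, smul_zero]⟩
    · exact localizedModule_map_exact _ (lcomp_exact hfg hg)
    · exact localizedModule_map_surjective _ fun φ => hN.exists_extension hf hfg hg φ
    · exact isWeaklyRegular_localizedModule (isWeaklyRegular_hom_free hC k)
    · rw [← List.map_dropLast]
      exact ih hK (isWeaklyRegular_dropLast hC) (by simp [hl])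

/-- At `p` the transpose is `Hom(K, C)` with `K` the kernel of `π.d`: restriction to `K` becomes
injective because `Ext^1(M, C)_p = 0`, and surjective because `Ext^1(I, C)_p = 0`. -/
lemma LocAcyclic.isWeaklyRegular_transpose [IsNoetherianRing R] {M : Type u} [AddCommGroup M]
    [Module R M] (hM : LocAcyclic p C M) (π : ProjPresentation R M) {rs : List R}
    (hC : IsWeaklyRegular C rs) : IsWeaklyRegular (LocalizedModule p.primeCompl (π.transpose C))
      (rs.map (algebraMap R (Localization.AtPrime p))) := by
  have := π.finite₁
  have := π.projective₁
  have := π.projective₀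
  let K := LinearMap.ker π.d
  let I := LinearMap.range π.d
  have hI : LocAcyclic p C I := hM.of_exact (f := I.subtype) (g := π.ε) Subtype.val_injective
    (by
      intro x
      rw [π.exact x]
      simp [I]) π.surjective
  have hexK : Function.Exact K.subtype π.d.rangeRestrict := by
    intro x
    rw [← LinearMap.mem_ker, LinearMap.ker_rangeRestrict]
    simp [K]
  have hK : LocAcyclic p C K := hI.of_exact (f := K.subtype) (g := π.d.rangeRestrict)
    Subtype.val_injective hexK π.d.surjective_rangeRestrict
  have hle : LinearMap.range (π.d.lcomp R C : (π.P₀ →ₗ[R] C) →ₗ[R] (π.P₁ →ₗ[R] C)) ≤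
      LinearMap.ker (K.subtype.lcomp R C) := by
    rintro _ ⟨φ, rfl⟩
    ext x
    have : π.d x = 0 := x.2
    simp [this]
  let Φ : π.transpose C →ₗ[R] (K →ₗ[R] C) := Submodule.liftQ _ (K.subtype.lcomp R C) hle
  have hinj : Function.Injective (LocalizedModule.map p.primeCompl Φ) := by
    refine localizedModule_map_injective _ fun x hx => ?_
    obtain ⟨g, rfl⟩ := Submodule.mkQ_surjective _ x
    obtain ⟨h, rfl⟩ := (lcomp_exact (Y := C) hexK π.d.surjective_rangeRestrict g).mp hx
    obtain ⟨s, hs, ψ, hψ⟩ := hM.exists_extension (f := I.subtype) (g := π.ε) Subtype.val_injective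
      (by
        intro x
        rw [π.exact x]
        simp [I]) π.surjective h
    refine ⟨s, hs, ?_⟩
    rw [← map_smul, Submodule.mkQ_apply, Submodule.Quotient.mk_eq_zero]
    refine ⟨ψ, ?_⟩
    ext x
    exact LinearMap.congr_fun hψ (π.d.rangeRestrict x)
  have hsurj : Function.Surjective (LocalizedModule.map p.primeCompl Φ) := by
    refine localizedModule_map_surjective _ fun φ => ?_
    obtain ⟨s, hs, ψ, hψ⟩ := hI.exists_extension (f := K.subtype) (g := π.d.rangeRestrict)
      Subtype.val_injective hexK π.d.surjective_rangeRestrict φ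
    exact ⟨s, hs, Submodule.mkQ _ ψ, hψ⟩
  exact ((LinearEquiv.ofBijective _ ⟨hinj, hsurj⟩).isWeaklyRegular_congr _).mpr
    (hK.isWeaklyRegular_hom hC)

lemma ProjPresentation.finite_transpose [IsNoetherianRing R] {M : Type u} [AddCommGroup M]
    [Module R M] (π : ProjPresentation R M) [Module.Finite R C] :
    Module.Finite R (π.transpose C) := by
  have := π.finite₁
  infer_instance

/-- At a prime where `C` has finite injective dimension, the transpose of a maximal
Cohen–Macaulay module is acyclic. -/
lemma locAcyclic_transpose [IsNoetherianRing R] [Module.Finite R C]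
    (hC : injectiveDimension (ModuleCat.of (Localization.AtPrime p)
      (LocalizedModule p.primeCompl C)) < ⊤) {rs : List R} (hmem : ∀ r ∈ rs, r ∈ p)
    (hlen : p.height = rs.length) (hreg : IsWeaklyRegular R rs) (hregC : IsWeaklyRegular C rs)
    {M : Type u} [AddCommGroup M] [Module R M] [Module.Finite R M] (hregM : IsWeaklyRegular M rs)
    (π : ProjPresentation R M) : LocAcyclic p C (π.transpose C) := by
  let A := Localization.AtPrime p
  -- `R_p` is Cohen–Macaulay of dimension `rs.length`. This is used twice: for `M`, then for its
  -- transpose.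
  have key : ∀ (N : Type u) [AddCommGroup N] [Module R N] [Module.Finite R N],
      IsWeaklyRegular (LocalizedModule p.primeCompl N) (rs.map (algebraMap R A)) →
      LocAcyclic p C N := fun N _ _ _ hN => by
    refine locAcyclic_of_extVanishes N fun i hi => ?_
    refine extVanishes_of_isWeaklyRegular_of_injectiveDimension hC (rs := rs.map (algebraMap R A))
      ?_ (hreg.of_isLocalization A p.primeCompl) ?_ _ hN i hi
    · intro r hr
      obtain ⟨r, hr', rfl⟩ := List.mem_map.mp hr
      exact (IsLocalization.AtPrime.to_map_mem_maximal_iff A p r).mpr (hmem r hr')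
    · rw [IsLocalization.AtPrime.ringKrullDim_eq_height p, hlen, List.length_map]
      rfl
  have := π.finite_transpose (C := C)
  exact key _ ((key M (isWeaklyRegular_localizedModule hregM)).isWeaklyRegular_transpose π hregC)

end

/-! ### Reflexivity of projective modules. -/

section bidual

variable {C : Type u} [AddCommGroup C] [Module R C]

lemma isSummandOfCopies_hom {P : Type u} [AddCommGroup P] [Module R P] [Module.Finite R P]
    [Module.Projective R P] : IsSummandOfCopies R C (P →ₗ[R] C) := by
  obtain ⟨k, f, s, -, -, hfs⟩ := Module.Finite.exists_comp_eq_id_of_projective R P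
  let e := LinearEquiv.piRing R C (Fin k) R
  refine ⟨k, e.toLinearMap ∘ₗ f.lcomp R C, s.lcomp R C ∘ₗ e.symm.toLinearMap, ?_⟩
  ext φ x
  have : f (s x) = x := LinearMap.congr_fun hfs x
  simp [e, this]

lemma IsSummandOfCopies.extVanishes_left {P Y : Type u} [AddCommGroup P] [Module R P]
    [AddCommGroup Y] [Module R Y] (hP : IsSummandOfCopies R C P) {i : ℕ}
    (h : ExtVanishes R C Y i) : ExtVanishes R P Y i := by
  obtain ⟨k, s, r, hrs⟩ := hP
  exact .retract_left s r hrs (h.pi_left k)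

/-- Finitely generated projective modules are `C`-reflexive. -/
lemma IsSemidualizing.applyₗ_bijective (hC : IsSemidualizing R C) (P : Type u) [AddCommGroup P]
    [Module R P] [Module.Finite R P] [Module.Projective R P] :
    Function.Bijective (LinearMap.applyₗ : P →ₗ[R] (P →ₗ[R] C) →ₗ[R] C) := by
  obtain ⟨k, r, s, -, -, hrs⟩ := Module.Finite.exists_comp_eq_id_of_projective R P
  have hrs' : ∀ x, r (s x) = x := fun x => LinearMap.congr_fun hrs x
  constructor
  · refine (injective_iff_map_eq_zero _).mpr fun x hx => ?_
    have h0 : s x = 0 := by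
      ext j
      refine hC.homothety_bijective.1 ?_
      ext c
      have := LinearMap.congr_fun hx ((LinearMap.toSpanSingleton R C c ∘ₗ LinearMap.proj j) ∘ₗ s)
      simpa using this
    rw [← hrs' x, h0, map_zero]
  · intro Φ
    -- Restricted to functionals that factor through the `j`-th coordinate, `Φ` is an endomorphism
    -- of `C`, hence a homothety.
    have h1 : ∀ j, ∃ a : R, LinearMap.lsmul R C a = Φ ∘ₗ s.lcomp R C ∘ₗ
        (LinearMap.proj (R := R) (φ := fun _ : Fin k => R) j).lcomp R C ∘ₗ
        (LinearMap.ringLmapEquivSelf R R C).symm.toLinearMap :=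
      fun j => hC.homothety_bijective.2 _
    choose a ha using h1
    refine ⟨r a, ?_⟩
    ext φ
    have hφ : ∀ y, φ (r y) = ∑ j, y j • φ (r fun i => if j = i then 1 else 0) :=
      fun y => LinearMap.pi_apply_eq_sum_univ (φ ∘ₗ r) y
    have h2 : φ = ∑ j, (LinearMap.toSpanSingleton R C (φ (r fun i => if j = i then 1 else 0)) ∘ₗ
        LinearMap.proj j) ∘ₗ s := by
      ext x
      rw [← congrArg φ (hrs' x), hφ, LinearMap.sum_apply]
      rfl
    have h3 : ∀ j c, a j • c = Φ ((LinearMap.toSpanSingleton R C c ∘ₗ LinearMap.proj j) ∘ₗ s) :=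
      fun j c => LinearMap.congr_fun (ha j) c
    rw [LinearMap.applyₗ_apply_apply, hφ]
    simp_rw [h3]
    rw [← map_sum, ← h2]

end bidual

/-! ### Construction and depth of syzygies. -/

section syzygy

variable {C : Type u} [AddCommGroup C] [Module R C]

lemma isSyzygy_zero (M : Type u) [AddCommGroup M] [Module R M] : IsSyzygy R 0 C M :=
  ⟨fun _ => ModuleCat.of R M, fun _ => 0, ⟨LinearEquiv.refl R M⟩, by omega, by omega, by omega⟩

lemma IsSyzygy.of_equiv {n : ℕ} {M N : Type u} [AddCommGroup M] [Module R M] [AddCommGroup N]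
    [Module R N] (e : M ≃ₗ[R] N) (h : IsSyzygy R n C N) : IsSyzygy R n C M := by
  obtain ⟨X, d, ⟨e'⟩, h⟩ := h
  exact ⟨X, d, ⟨e.trans e'⟩, h⟩

lemma IsSyzygy.succ {n : ℕ} {M X N : Type u} [AddCommGroup M] [Module R M] [AddCommGroup X]
    [Module R X] [AddCommGroup N] [Module R N] {f : M →ₗ[R] X} {g : X →ₗ[R] N}
    (hf : Function.Injective f) (hfg : Function.Exact f g) (hg : Function.Surjective g)
    (hX : IsSummandOfCopies R C X) (hN : IsSyzygy R n C N) : IsSyzygy R (n + 1) C M := by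
  obtain ⟨Y, d, ⟨e⟩, h1, h2, h3⟩ := hN
  let Z : ℕ → ModuleCat.{u} R := fun i => match i with
    | 0 => ModuleCat.of R M
    | 1 => ModuleCat.of R X
    | i + 2 => Y (i + 1)
  let δ : ∀ i, Z i →ₗ[R] Z (i + 1) := fun i => match i with
    | 0 => f
    | 1 => d 0 ∘ₗ e.toLinearMap ∘ₗ g
    | i + 2 => d (i + 1)
  refine ⟨Z, δ, ⟨LinearEquiv.refl R M⟩, ?_, fun _ => hf, ?_⟩
  · intro i hi hin
    match i with
    | 1 => exact hX
    | i + 2 => exact h1 (i + 1) (by omega) (by omega)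
  · intro i hi
    match i with
    | 0 =>
      intro x
      rw [← hfg x]
      change d 0 (e (g x)) = 0 ↔ _
      rw [(injective_iff_map_eq_zero' (d 0)).mp (h2 (by omega)), e.map_eq_zero_iff]
    | 1 =>
      intro x
      rw [show δ (1 + 1) x = d 1 x from rfl, h3 0 (by omega) x]
      constructor
      · rintro ⟨y, rfl⟩
        obtain ⟨z, hz⟩ := hg (e.symm y)
        exact ⟨z, by change d 0 (e (g z)) = _; rw [hz, e.apply_symm_apply]⟩
      · rintro ⟨z, rfl⟩
        exact ⟨e (g z), rfl⟩
    | i + 2 => exact h3 (i + 1) (by omega)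

lemma IsSyzygy.one_of_injective {M X : Type u} [AddCommGroup M] [Module R M] [AddCommGroup X]
    [Module R X] {f : M →ₗ[R] X} (hf : Function.Injective f) (hX : IsSummandOfCopies R C X) :
    IsSyzygy R 1 C M :=
  .succ hf f.exact_map_mkQ_range (Submodule.mkQ_surjective _) hX (isSyzygy_zero _)

/-- Dualize a free resolution of `Z`. Left exactness of `Hom` gives two terms for free, and each
vanishing `Ext` gives one more. -/
lemma isSyzygy_hom [IsNoetherianRing R] (m : ℕ) (Z : Type u) [AddCommGroup Z] [Module R Z]
    [Module.Finite R Z] (hZ : ∀ i, 1 ≤ i → i ≤ m → ExtVanishes R Z C i) :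
    IsSyzygy R (m + 2) C (Z →ₗ[R] C) := by
  induction m generalizing Z with
  | zero =>
    obtain ⟨k, K, _, _, _, f, g, hf, hfg, hg⟩ := exists_free_cover R Z
    obtain ⟨l, L, _, _, _, f', g', hf', hfg', hg'⟩ := exists_free_cover R K
    refine .succ (f := g.lcomp R C) (g := (f.lcomp R C).rangeRestrict) (lcomp_injective hg) ?_
      (LinearMap.surjective_rangeRestrict _) isSummandOfCopies_hom ?_
    · intro x
      rw [← lcomp_exact hfg hg x, ← LinearMap.mem_ker, LinearMap.ker_rangeRestrict, LinearMap.mem_ker]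
    · exact .one_of_injective (f := g'.lcomp R C ∘ₗ Submodule.subtype _)
        ((lcomp_injective hg').comp Subtype.val_injective) isSummandOfCopies_hom
  | succ m ih =>
    obtain ⟨k, K, _, _, _, f, g, hf, hfg, hg⟩ := exists_free_cover R Z
    refine .succ (lcomp_injective hg) (lcomp_exact hfg hg)
      ((hZ 1 le_rfl (by omega)).exists_extension hf hfg hg) isSummandOfCopies_hom ?_
    refine ih K fun i h1 hi => ?_
    exact .contra₁ hf hfg hg (extVanishes_of_projective i h1) (hZ (i + 1) (by omega) (by omega))

/-- A `n`-`C`-syzygy module is as deep as `C`, up to `n`. -/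
lemma IsSyzygy.isWeaklyRegular {n : ℕ} {M : Type u} [AddCommGroup M] [Module R M]
    (hM : IsSyzygy R n C M) {rs : List R} (hlen : rs.length ≤ n) (hC : IsWeaklyRegular C rs) :
    IsWeaklyRegular M rs := by
  obtain ⟨X, d, ⟨e⟩, h1, h2, h3⟩ := hM
  cases n with
  | zero =>
    rw [List.length_eq_zero_iff.mp (Nat.le_zero.mp hlen)]
    exact .nil _ _
  | succ n =>
  -- `k` counts the terms from `X (j + 1)` to the end; each use of the depth lemma costs one. When
  -- `k = 1` the cokernel is unrestricted, but only the empty sequence is asked of it.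
  have key : ∀ k j, j + k = n + 1 → ∀ rs : List R, rs.length ≤ k → IsWeaklyRegular C rs →
      IsWeaklyRegular (LinearMap.range (d j)) rs := by
    intro k
    induction k with
    | zero =>
      intro j _ rs hrs _
      rw [List.length_eq_zero_iff.mp (Nat.le_zero.mp hrs)]
      exact .nil _ _
    | succ k ih =>
      intro j hj rs hrs hC
      have hX := (h1 (j + 1) (by omega) (by omega)).isWeaklyRegular hC
      rcases Nat.eq_zero_or_pos k with rfl | hk
      · refine isWeaklyRegular_of_dropLast rs (f := (LinearMap.range (d j)).subtype)
          Subtype.val_injective (LinearMap.exact_subtype_mkQ _) (Submodule.mkQ_surjective _) hX ?_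
        have : rs.dropLast = [] := List.length_eq_zero_iff.mp (by rw [List.length_dropLast]; omega)
        rw [this]
        exact .nil _ _
      · refine isWeaklyRegular_of_dropLast rs (f := (LinearMap.range (d j)).subtype)
          (g := (d (j + 1)).rangeRestrict) Subtype.val_injective ?_
          (LinearMap.surjective_rangeRestrict _) hX
          (ih (j + 1) (by omega) _ (by rw [List.length_dropLast]; omega) (isWeaklyRegular_dropLast hC))
        intro x
        rw [← LinearMap.mem_ker, LinearMap.ker_rangeRestrict, LinearMap.mem_ker,
          h3 j (by omega) x]
        simp
  have h0 := key (n + 1) 0 (by omega) rs hlen hC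
  exact (((e.trans (LinearEquiv.ofInjective (d 0) (h2 (by omega)))).isWeaklyRegular_congr rs).mpr h0)

end syzygy

/-! ### The transpose and the biduality map. -/

section transpose

variable {C : Type u} [AddCommGroup C] [Module R C] {M : Type u} [AddCommGroup M] [Module R M]
  (π : ProjPresentation R M)

variable (C) in
/-- The image of `Hom(P₀, C) → Hom(P₁, C)`. -/
abbrev ProjPresentation.dualRange : Submodule R (π.P₁ →ₗ[R] C) :=
  LinearMap.range (π.d.lcomp R C : (π.P₀ →ₗ[R] C) →ₗ[R] (π.P₁ →ₗ[R] C))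

variable (C) in
/-- The map from `Hom(P₀, C)` onto its image in `Hom(P₁, C)`. -/
abbrev ProjPresentation.toDualRange : (π.P₀ →ₗ[R] C) →ₗ[R] π.dualRange C :=
  (π.d.lcomp R C : (π.P₀ →ₗ[R] C) →ₗ[R] (π.P₁ →ₗ[R] C)).rangeRestrict

lemma ProjPresentation.exact_toDualRange :
    Function.Exact (π.ε.lcomp R C) (π.toDualRange C) := by
  intro x
  rw [← lcomp_exact π.exact π.surjective x, ← LinearMap.mem_ker, LinearMap.ker_rangeRestrict,
    LinearMap.mem_ker]

lemma ProjPresentation.isSummandOfCopies₀ : IsSummandOfCopies R C (π.P₀ →ₗ[R] C) := by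
  have := π.finite₀
  have := π.projective₀
  exact isSummandOfCopies_hom

lemma ProjPresentation.isSummandOfCopies₁ : IsSummandOfCopies R C (π.P₁ →ₗ[R] C) := by
  have := π.finite₁
  have := π.projective₁
  exact isSummandOfCopies_hom

lemma ProjPresentation.bijective₀ (hC : IsSemidualizing R C) :
    Function.Bijective (LinearMap.applyₗ : π.P₀ →ₗ[R] (π.P₀ →ₗ[R] C) →ₗ[R] C) := by
  have := π.finite₀
  have := π.projective₀
  exact hC.applyₗ_bijective _

lemma ProjPresentation.bijective₁ (hC : IsSemidualizing R C) :
    Function.Bijective (LinearMap.applyₗ : π.P₁ →ₗ[R] (π.P₁ →ₗ[R] C) →ₗ[R] C) := by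
  have := π.finite₁
  have := π.projective₁
  exact hC.applyₗ_bijective _

lemma ProjPresentation.extVanishes_dualRange (hC : IsSemidualizing R C) {i : ℕ} (hi : 0 < i)
    (h : ExtVanishes R (π.transpose C) C (i + 1)) : ExtVanishes R (π.dualRange C) C i :=
  .contra₁ (f := (π.dualRange C).subtype) (g := (π.dualRange C).mkQ) Subtype.val_injective
    (LinearMap.exact_subtype_mkQ _) (Submodule.mkQ_surjective _)
    (π.isSummandOfCopies₁.extVanishes_left (hC.ext_vanishes i hi)) h

/-- Two dimension shifts through the image of `Hom(P₀, C)` in `Hom(P₁, C)`; both duals are summands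
of copies of `C`, so they have no higher `Ext` into `C`. -/
lemma ProjPresentation.extVanishes_hom (hC : IsSemidualizing R C) {i : ℕ} (hi : 0 < i)
    (h : ExtVanishes R (π.transpose C) C (i + 2)) : ExtVanishes R (M →ₗ[R] C) C i :=
  .contra₁ (lcomp_injective π.surjective) π.exact_toDualRange
    (LinearMap.surjective_rangeRestrict _)
    (π.isSummandOfCopies₀.extVanishes_left (hC.ext_vanishes i hi))
    (π.extVanishes_dualRange hC i.succ_pos h)

/-- A lift to `P₀` of an element dying in the bidual defines a functional on the dual range. It
extends to `Hom(P₁, C)`, and reflexivity of `P₁` yields a preimage under `π.d`. -/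
lemma ProjPresentation.applyₗ_injective (hC : IsSemidualizing R C)
    (h : ExtVanishes R (π.transpose C) C 1) :
    Function.Injective (LinearMap.applyₗ : M →ₗ[R] (M →ₗ[R] C) →ₗ[R] C) := by
  refine (injective_iff_map_eq_zero _).mpr fun x hx => ?_
  obtain ⟨z, rfl⟩ := π.surjective x
  have hz : (π.ε.lcomp R C).lcomp R C (LinearMap.applyₗ z) = 0 := by
    ext φ
    exact LinearMap.congr_fun hx φ
  obtain ⟨f, hf⟩ := (lcomp_exact (Y := C) π.exact_toDualRange
    (LinearMap.surjective_rangeRestrict _) _).mp hz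
  obtain ⟨ψ, hψ⟩ := h.exists_extension (f := (π.dualRange C).subtype) (g := (π.dualRange C).mkQ)
    Subtype.val_injective (LinearMap.exact_subtype_mkQ _) (Submodule.mkQ_surjective _) f
  obtain ⟨y, rfl⟩ := (π.bijective₁ hC).2 ψ
  have : π.d y = z := by
    refine (π.bijective₀ hC).1 ?_
    rw [← hf, ← hψ]
    rfl
  rw [← this, π.exact.apply_apply_eq_zero]

lemma ProjPresentation.applyₗ_surjective (hC : IsSemidualizing R C)
    (h : ExtVanishes R (π.transpose C) C 2) :
    Function.Surjective (LinearMap.applyₗ : M →ₗ[R] (M →ₗ[R] C) →ₗ[R] C) := by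
  intro f
  obtain ⟨ψ, hψ⟩ := (π.extVanishes_dualRange hC one_pos h).exists_extension
    (lcomp_injective π.surjective) π.exact_toDualRange (LinearMap.surjective_rangeRestrict _) f
  obtain ⟨z, rfl⟩ := (π.bijective₀ hC).2 ψ
  exact ⟨π.ε z, hψ⟩

/-- Torsionfree modules are syzygies. -/
lemma IsTorsionfree.isSyzygy [IsNoetherianRing R] [Module.Finite R M] {n : ℕ}
    (hC : IsSemidualizing R C) (h : IsTorsionfree R n C M) : IsSyzygy R n C M := by
  obtain ⟨π, hπ⟩ := h
  have := hC.finite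
  match n with
  | 0 => exact isSyzygy_zero M
  | 1 =>
    obtain ⟨k, K, _, _, _, f, g, hf, hfg, hg⟩ := exists_free_cover R (M →ₗ[R] C)
    exact .one_of_injective (f := g.lcomp R C ∘ₗ LinearMap.applyₗ)
      ((lcomp_injective hg).comp (π.applyₗ_injective hC (hπ 1 le_rfl le_rfl)))
      isSummandOfCopies_hom
  | n + 2 =>
    refine .of_equiv (LinearEquiv.ofBijective _ ⟨π.applyₗ_injective hC (hπ 1 le_rfl (by omega)),
      π.applyₗ_surjective hC (hπ 2 (by omega) (by omega))⟩) (isSyzygy_hom n _ fun i h1 hi => ?_)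
    exact π.extVanishes_hom hC h1 (hπ (i + 2) (by omega) (by omega))

end transpose

/-! ### Depth and torsion in `Ext`. -/

section depth

variable {C : Type u} [AddCommGroup C] [Module R C] {p : Ideal R}

lemma extVanishes_quotient_of_mem {N : Type u} [AddCommGroup N] [Module R N] {rs : List R}
    (hmem : ∀ r ∈ rs, r ∈ p) (hN : IsWeaklyRegular N rs) {i : ℕ} (hi : i < rs.length) :
    ExtVanishes R (R ⧸ p) N i :=
  extVanishes_of_isWeaklyRegular rs (fun r hr => mem_annihilator_quotient (hmem r hr)) hN i hi

/-- If `Hom(Z, C)` has depth at least `m + 3` at `p` and `Ext^i(Z, C) = 0` for `1 ≤ i ≤ m`, then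
`Ext^{m+1}(Z, C)` has no `p`-torsion. -/
lemma ext_eq_zero_of_depth [IsNoetherianRing R] {rs : List R} (hmem : ∀ r ∈ rs, r ∈ p)
    (hC : IsWeaklyRegular C rs) (m : ℕ) (hm : m + 3 ≤ rs.length) (Z : Type u) [AddCommGroup Z] [Module R Z] [Module.Finite R Z]
    (hZ : ∀ i, 1 ≤ i → i ≤ m → ExtVanishes R Z C i)
    (hdual : ∀ i < m + 3, ExtVanishes R (R ⧸ p) (Z →ₗ[R] C) i)
    (e : Ext (ModuleCat.of R Z) (ModuleCat.of R C) (m + 1)) (he : ∀ s ∈ p, s • e = 0) : e = 0 := by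
  have hF : ∀ k : ℕ, ∀ i < rs.length, ExtVanishes R (R ⧸ p) ((Fin k → R) →ₗ[R] C) i :=
    fun k i hi => extVanishes_quotient_of_mem hmem (isWeaklyRegular_hom_free hC k) hi
  induction m generalizing Z with
  | zero =>
    obtain ⟨k, K, _, _, _, f, g, hf, hfg, hg⟩ := exists_free_cover R Z
    obtain ⟨l, L, _, _, _, f', g', hf', hfg', hg'⟩ := exists_free_cover R K
    obtain ⟨δ, hδ, hδ'⟩ := exists_connecting_zero (Y := C) hf hfg hg
    obtain ⟨φ, rfl⟩ := hδ' (extVanishes_of_projective _ one_pos) e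
    let B := LinearMap.range (f.lcomp R C)
    have hex : Function.Exact (g.lcomp R C) (f.lcomp R C).rangeRestrict := by
      intro x
      rw [← lcomp_exact hfg hg x, ← LinearMap.mem_ker, LinearMap.ker_rangeRestrict,
        LinearMap.mem_ker]
    -- `Ext^1(Z, C)` is `Hom(K, C)/B`, so `Ext^1(R/p, B) = 0` excludes `p`-torsion; it comes from
    -- the vanishing of `Ext^2(R/p, Hom(Z, C))`.
    have hB : ExtVanishes R (R ⧸ p) B 1 := .cov₃ (lcomp_injective hg) hex
      (LinearMap.surjective_rangeRestrict _) (hF k 1 (by omega)) (hdual 2 (by omega))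
    have hK : ExtVanishes R (R ⧸ p) (K →ₗ[R] C) 0 :=
      .of_injective (lcomp_injective hg') (hF l 0 (by omega))
    have hQ : ExtVanishes R (R ⧸ p) ((K →ₗ[R] C) ⧸ B) 0 :=
      .cov₃ (f := B.subtype) (g := B.mkQ) Subtype.val_injective (LinearMap.exact_subtype_mkQ _)
        (Submodule.mkQ_surjective _) hK hB
    have h0 : B.mkQ φ = 0 := (extVanishes_zero_quotient_iff p).mp hQ _ fun s hs => by
      rw [← map_smul, Submodule.mkQ_apply, Submodule.Quotient.mk_eq_zero]
      exact (hδ _).mp (by rw [map_smul, he s hs])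
    rw [Submodule.mkQ_apply, Submodule.Quotient.mk_eq_zero] at h0
    exact (hδ _).mpr h0
  | succ m ih =>
    obtain ⟨k, K, _, _, _, f, g, hf, hfg, hg⟩ := exists_free_cover R Z
    obtain ⟨δ, hδ, hδ'⟩ := exists_connecting (Y := C) hf hfg hg (m + 1)
      (extVanishes_of_projective _ (by omega))
    obtain ⟨e, rfl⟩ := hδ e
    rw [ih (by omega) K ?_ ?_ e ?_, map_zero]
    · exact fun i h1 hi => .contra₁ hf hfg hg (extVanishes_of_projective i h1)
        (hZ (i + 1) (by omega) (by omega))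
    · exact fun i hi => .cov₃ (lcomp_injective hg) (lcomp_exact hfg hg)
        ((hZ 1 le_rfl (by omega)).exists_extension hf hfg hg) (hF k i (by omega))
        (hdual (i + 1) (by omega))
    · intro s hs
      refine hδ' (extVanishes_of_projective _ (by omega)) ?_
      rw [map_smul, he s hs, map_zero]

/-- In degrees one and two the `Ext` of the transpose measures the kernel and cokernel of biduality,
treated directly. From degree three on, `M` is reflexive and two shifts lead to `Hom(M, C)`, whose
dual is `M` and has the required depth. -/
lemma ProjPresentation.ext_eq_zero_of_depth [IsNoetherianRing R] {M : Type u} [AddCommGroup M] [Module R M]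
    [Module.Finite R M] (π : ProjPresentation R M) (hC : IsSemidualizing R C) {rs : List R}
    (hmem : ∀ r ∈ rs, r ∈ p) (hreg : IsWeaklyRegular R rs) (hM : IsWeaklyRegular M rs)
    (n : ℕ) (hn : n + 1 ≤ rs.length)
    (hT : ∀ i, 1 ≤ i → i ≤ n → ExtVanishes R (π.transpose C) C i)
    (e : Ext (ModuleCat.of R (π.transpose C)) (ModuleCat.of R C) (n + 1))
    (he : ∀ s ∈ p, s • e = 0) : e = 0 := by
  have hCreg := hC.isWeaklyRegular hreg
  have := hC.finite
  have hM0 : ∀ i < rs.length, ExtVanishes R (R ⧸ p) M i :=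
    fun i hi => extVanishes_quotient_of_mem hmem hM hi
  have hB0 : ∀ i, 0 < i → ExtVanishes R (π.P₁ →ₗ[R] C) C i :=
    fun i hi => π.isSummandOfCopies₁.extVanishes_left (hC.ext_vanishes i hi)
  have hB1 : ∀ i, 0 < i → ExtVanishes R (π.P₀ →ₗ[R] C) C i :=
    fun i hi => π.isSummandOfCopies₀.extVanishes_left (hC.ext_vanishes i hi)
  match n with
  | 0 =>
    obtain ⟨δ, hδ, hδ'⟩ := exists_connecting_zero (Y := C) (f := (π.dualRange C).subtype)
      (g := (π.dualRange C).mkQ) Subtype.val_injective (LinearMap.exact_subtype_mkQ _)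
      (Submodule.mkQ_surjective _)
    obtain ⟨φ, rfl⟩ := hδ' (hB0 1 one_pos) e
    obtain ⟨z, hz⟩ := (π.bijective₀ hC).2 (φ ∘ₗ π.toDualRange C)
    have hεz : π.ε z = 0 := by
      refine (extVanishes_zero_quotient_iff p).mp (hM0 0 (by omega)) _ fun s hs => ?_
      obtain ⟨ψ, hψ⟩ := (hδ _).mp (show δ (s • φ) = 0 by rw [map_smul, he s hs])
      obtain ⟨y, rfl⟩ := (π.bijective₁ hC).2 ψ
      have : π.d y = s • z := by
        refine (π.bijective₀ hC).1 ?_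
        rw [map_smul, hz]
        ext g
        exact LinearMap.congr_fun hψ (π.toDualRange C g)
      rw [← map_smul, ← this, π.exact.apply_apply_eq_zero]
    obtain ⟨y, rfl⟩ := (π.exact z).mp hεz
    refine (hδ _).mpr ⟨LinearMap.applyₗ y, ?_⟩
    ext b
    obtain ⟨g, rfl⟩ := (π.d.lcomp R C).surjective_rangeRestrict b
    exact LinearMap.congr_fun hz g
  | 1 =>
    obtain ⟨δ, hδ, hδ'⟩ := exists_connecting (Y := C) (f := (π.dualRange C).subtype)
      (g := (π.dualRange C).mkQ) Subtype.val_injective (LinearMap.exact_subtype_mkQ _)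
      (Submodule.mkQ_surjective _) 1 (hB0 2 two_pos)
    obtain ⟨e, rfl⟩ := hδ e
    have he' : ∀ s ∈ p, s • e = 0 := fun s hs =>
      hδ' (hB0 1 one_pos) (by rw [map_smul, he s hs, map_zero])
    obtain ⟨δ', hδ₁, hδ₂⟩ := exists_connecting_zero (Y := C) (f := π.ε.lcomp R C)
      (g := π.toDualRange C) (lcomp_injective π.surjective) π.exact_toDualRange
      (LinearMap.surjective_rangeRestrict _)
    obtain ⟨φ, rfl⟩ := hδ₂ (hB1 1 one_pos) e
    obtain ⟨k, K, _, _, _, f, g, hf, hfg, hg⟩ := exists_free_cover R (M →ₗ[R] C)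
    have hdd : ExtVanishes R (R ⧸ p) ((M →ₗ[R] C) →ₗ[R] C) 0 :=
      .of_injective (lcomp_injective hg)
        (extVanishes_quotient_of_mem hmem (isWeaklyRegular_hom_free hCreg k) (by omega))
    let η : M →ₗ[R] (M →ₗ[R] C) →ₗ[R] C := LinearMap.applyₗ
    -- Depth two of `M` and depth one of its bidual leave no `p`-torsion in the cokernel.
    have hQ : ExtVanishes R (R ⧸ p) (((M →ₗ[R] C) →ₗ[R] C) ⧸ LinearMap.range η) 0 :=
      .cov₃ (f := η) (g := (LinearMap.range η).mkQ) (π.applyₗ_injective hC (hT 1 le_rfl le_rfl))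
        (LinearMap.exact_map_mkQ_range η) (Submodule.mkQ_surjective _) hdd (hM0 1 (by omega))
    have h0 : (LinearMap.range η).mkQ φ = 0 :=
      (extVanishes_zero_quotient_iff p).mp hQ _ fun s hs => by
        rw [← map_smul, Submodule.mkQ_apply, Submodule.Quotient.mk_eq_zero]
        obtain ⟨ψ, hψ⟩ := (hδ₁ _).mp (show δ' (s • φ) = 0 by rw [map_smul, he' s hs])
        obtain ⟨z, rfl⟩ := (π.bijective₀ hC).2 ψ
        exact ⟨π.ε z, hψ⟩
    rw [Submodule.mkQ_apply, Submodule.Quotient.mk_eq_zero] at h0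
    obtain ⟨x, rfl⟩ := h0
    obtain ⟨z, rfl⟩ := π.surjective x
    rw [show δ' (η (π.ε z)) = 0 from (hδ₁ _).mpr ⟨LinearMap.applyₗ z, rfl⟩, map_zero]
  | m + 2 =>
    obtain ⟨δ, hδ, hδ'⟩ := exists_connecting (Y := C) (f := (π.dualRange C).subtype)
      (g := (π.dualRange C).mkQ) Subtype.val_injective (LinearMap.exact_subtype_mkQ _)
      (Submodule.mkQ_surjective _) (m + 2) (hB0 _ (by omega))
    obtain ⟨e, rfl⟩ := hδ e
    obtain ⟨δ', hδ₁, hδ₂⟩ := exists_connecting (Y := C) (f := π.ε.lcomp R C)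
      (g := π.toDualRange C) (lcomp_injective π.surjective) π.exact_toDualRange
      (LinearMap.surjective_rangeRestrict _) (m + 1) (hB1 _ (by omega))
    obtain ⟨e, rfl⟩ := hδ₁ e
    let η : M ≃ₗ[R] ((M →ₗ[R] C) →ₗ[R] C) := LinearEquiv.ofBijective LinearMap.applyₗ
      ⟨π.applyₗ_injective hC (hT 1 le_rfl (by omega)),
        π.applyₗ_surjective hC (hT 2 (by omega) (by omega))⟩
    rw [SemidualizingTorsion.ext_eq_zero_of_depth hmem hCreg m (by omega) (M →ₗ[R] C) ?_ ?_ e ?_,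
      map_zero, map_zero]
    · exact fun i h1 hi => π.extVanishes_hom hC h1 (hT (i + 2) (by omega) (by omega))
    · exact fun i hi => .equiv_right η.symm (hM0 i (by omega))
    · intro s hs
      refine hδ₂ (hB1 _ (by omega)) (hδ' (hB0 _ (by omega)) ?_)
      rw [map_smul, map_smul, he s hs, map_zero, map_zero]

end depth

/-! ### From regular sequences to torsionfreeness, and the equivalence. -/

/-- Modules on which regular sequences of length at most `n` stay regular are torsionfree. -/
lemma isTorsionfree_of_isWeaklyRegular [IsNoetherianRing R] {C M : Type u} [AddCommGroup C]
    [Module R C] [AddCommGroup M] [Module R M] [Module.Finite R M] {n : ℕ}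
    (hC : IsSemidualizing R C) (hS : SatisfiesS R n) (hG : SatisfiesG R ((n : ℤ) - 1) C)
    (hM : ∀ rs : List R, rs.length ≤ n → IsWeaklyRegular R rs → IsWeaklyRegular M rs) :
    IsTorsionfree R n C M := by
  have := hC.finite
  obtain ⟨k, K, _, _, _, f, g, hf, hfg, hg⟩ := exists_free_cover R M
  obtain ⟨l, L, _, _, _, f', g', hf', hfg', hg'⟩ := exists_free_cover R K
  let π : ProjPresentation R M :=
    { P₁ := ModuleCat.of R (Fin l → R)
      P₀ := ModuleCat.of R (Fin k → R)
      finite₁ := inferInstanceAs (Module.Finite R (Fin l → R))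
      finite₀ := inferInstanceAs (Module.Finite R (Fin k → R))
      projective₁ := inferInstanceAs (Module.Projective R (Fin l → R))
      projective₀ := inferInstanceAs (Module.Projective R (Fin k → R))
      d := f ∘ₗ g'
      ε := g
      exact := by
        intro x
        rw [hfg x]
        exact ⟨fun ⟨y, hy⟩ => (hg' y).imp fun z hz => by simp [hz, hy], fun ⟨z, hz⟩ => ⟨g' z, hz⟩⟩
      surjective := hg }
  refine ⟨π, fun i => ?_⟩
  induction i using Nat.strong_induction_on with
  | _ i ih =>
  intro h1 hin
  obtain ⟨j, rfl⟩ : ∃ j, i = j + 1 := ⟨i - 1, by omega⟩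
  unfold ExtVanishes
  by_contra hne
  rw [not_subsingleton_iff_nontrivial] at hne
  obtain ⟨p, hp⟩ := associatedPrimes.nonempty R
    (Ext (ModuleCat.of R (π.transpose C)) (ModuleCat.of R C) (j + 1))
  obtain ⟨hpp, e, he⟩ := isAssociatedPrime_iff.mp hp
  replace he : ∀ s, s ∈ p ↔ s • e = 0 := fun s => by
    rw [he, Submodule.mem_colon_singleton, Submodule.mem_bot]
  have he0 : e ≠ 0 := fun h => hpp.ne_top ((Ideal.eq_top_iff_one p).mpr ((he 1).mpr (by simp [h])))
  rcases le_or_gt ((j + 1 : ℕ) : ℕ∞) p.height with hle | hlt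
  · obtain ⟨rs, hlen, hmem, hreg⟩ := hS.exists_isWeaklyRegular p (j + 1) hin hle
    exact he0 (π.ext_eq_zero_of_depth hC hmem hreg (hM rs (by omega) hreg) j (by omega)
      (fun i h1 hi => ih i (by omega) h1 (by omega)) e fun s hs => (he s).mp hs)
  -- Here `h ≤ j ≤ n - 1`, exactly the range of the injective dimension hypothesis.
  · obtain ⟨h, hh⟩ := ENat.ne_top_iff_exists.mp (ne_top_of_lt hlt)
    rw [← hh] at hlt
    have hlt' : h < j + 1 := by exact_mod_cast hlt
    obtain ⟨rs, hlen, hmem, hreg⟩ := hS.exists_isWeaklyRegular p h (by omega) hh.le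
    obtain ⟨s, hs, hse⟩ := locAcyclic_transpose (hG p h hh.symm (by omega)) hmem
      (by rw [hlen, hh]) hreg (hC.isWeaklyRegular hreg) (hM rs (by omega) hreg) π (j + 1)
      (by omega) e
    exact hs ((he s).mpr hse)

end SemidualizingTorsion

theorem corollary3p2 {R : Type u} [CommRing R] [IsNoetherianRing R] (n : ℕ)
    (C C' : Type u) [AddCommGroup C] [Module R C] [AddCommGroup C'] [Module R C']
    (hC : SemidualizingTorsion.IsSemidualizing R C)
    (hC' : SemidualizingTorsion.IsSemidualizing R C')
    (hS : SemidualizingTorsion.SatisfiesS R n)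
    (hG : SemidualizingTorsion.SatisfiesG R ((n : ℤ) - 1) C)
    (hG' : SemidualizingTorsion.SatisfiesG R ((n : ℤ) - 1) C')
    (M : Type u) [AddCommGroup M] [Module R M] [Module.Finite R M] :
    List.TFAE
      [SemidualizingTorsion.IsTorsionfree R n C M,
       SemidualizingTorsion.IsTorsionfree R n C' M,
       SemidualizingTorsion.IsSyzygy R n C M,
       SemidualizingTorsion.IsSyzygy R n C' M] := by
  tfae_have 1 → 3 := fun h => h.isSyzygy hC
  tfae_have 2 → 4 := fun h => h.isSyzygy hC'
  -- The semidualizing module changes here: syzygies over `C` control `R`-regular sequences on `M`,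
  -- which yield torsionfreeness over `C'`.
  tfae_have 3 → 2 := fun h =>
    SemidualizingTorsion.isTorsionfree_of_isWeaklyRegular hC' hS hG' fun _ hlen hreg =>
      h.isWeaklyRegular hlen (hC.isWeaklyRegular hreg)
  tfae_have 4 → 1 := fun h =>
    SemidualizingTorsion.isTorsionfree_of_isWeaklyRegular hC hS hG fun _ hlen hreg =>
      h.isWeaklyRegular hlen (hC'.isWeaklyRegular hreg)
  tfae_finish
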